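/- Let $r\ge 1$ and $m\ge 0$ be integers with $m\ge r-1$, and let $a:\mathbb Z\to\mathbb C^{r\times r}$ be finitely supported (a mask). For a finitely supported sequence $u$ on $\mathbb Z$ write $\widehat u(\xi)=\sum_{k\in\mathbb Z}u(k)e^{-ik\xi}$; for an integrable (vector-valued) function $f$ on $\mathbb R$ write $\widehat f(\xi)=\int_{\mathbb R}f(x)e^{-i\xi x}\,dx$. Let $(S_av)(j)=2\sum_{k\in\mathbb Z}v(k)a(j-2k)$ for sequences $v$ of $s\times r$ matrices, let $D=\mathrm{diag}(1,2^{-1},\dots,2^{1-r})$, and let $e_1=(1,0,\dots,0)^{T}\in\mathbb C^r$. Assume that the Hermite subdivision scheme of order $r$ with mask $a$ is convergent with limiting functions in $C^m(\mathbb R)$: for every $w_0:\mathbb Z\to\mathbb C^{1\times r}$ there is $\eta\in C^m(\mathbb R)$, $\eta:\mathbb R\to\mathbb C$, such that, with $w_n=(S_a^nw_0)D^{-n}$, for every $K>0$, $$\lim_{n\to\infty}\ \max_{k\in\mathbb Z\cap[-2^nK,2^nK]}\big\|w_n(k)-[\eta(2^{-n}k),\eta'(2^{-n}k),\dots,\eta^{(r-1)}(2^{-n}k)]\big\|_{\ell_\infty}=0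 .$$ Let $\varphi=(\varphi_1,\dots,\varphi_r)^{T}$ be its basis vector function, that is, the compactly supported vector function with components in $C^m(\mathbb R)$ satisfying $$\lim_{n\to\infty}\ \sup_{k\in\mathbb Z}\big\|(S_a^n(\delta I_r))(k)D^{-n}-[\varphi,\varphi',\dots,\varphi^{(r-1)}](2^{-n}k)\big\|=0,$$ where $\delta(0)=1$ and $\delta(k)=0$ for $k\neq0$. Suppose that $$\mathrm{span}\{\widehat\varphi(2\pi k):k\in\mathbb Z\}=\mathbb C^r\quad\text{and}\quad \mathrm{span}\{\widehat\varphi(\pi+2\pi k):k\in\mathbb Z\}=\mathbb C^r .$$ Then the following hold. (1) $1$ is a simple eigenvalue of $\widehat a(0)$ (of algebraic multiplicity one), and all other eigenvalues of $\widehat a(0)$ are less than $2^{-m}$ in modulus. (2) $a$ is a Hermite mask of accuracy order $m+1$: there is a finitely supported $\upsilon:\mathbb Z\to\mathbb C^{1\times r}$ with $\widehat\upsilon(0)\ne0$ such that, as $\xi\to0$, $$\widehat\upsilon(2\xi)\widehat a(\xi)=\widehat\upsilon(\xi)+O(|\xi|^{m+1}),\qquad \widehat\upsilon(2\xi)\widehat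 a(\xi+\pi)=O(|\xi|^{m+1}),$$ and $$\widehat\upsilon(\xi)=\big(1+O(|\xi|),\,i\xi+O(|\xi|^2),\,\dots,\,(i\xi)^{r-1}+O(|\xi|^r)\big),$$ that is, for some finitely supported $c_1,\dots,c_r:\mathbb Z\to\mathbb C$ with $\widehat{c_1}(0)=\dots=\widehat{c_r}(0)=1$, $$\widehat\upsilon(\xi)=\big(\widehat{c_1}(\xi),\,i\xi\,\widehat{c_2}(\xi),\,\dots,\,(i\xi)^{r-1}\widehat{c_r}(\xi)\big)+O(|\xi|^{m+1}).$$ (3) $\varphi=2\sum_{k\in\mathbb Z}a(k)\varphi(2\,\cdot-k)$, $e_1^{T}\widehat\varphi(0)=1$, and for every $\xi\in\mathbb R$ $$\widehat\varphi(\xi)=\lim_{n\to\infty}\big[\widehat a(2^{-1}\xi)\,\widehat a(2^{-2}\xi)\cdots\widehat a(2^{-n}\xi)\big]e_1 .$$ -/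

import Mathlib

open Filter Topology Asymptotics

namespace HermiteSubdivision

noncomputable section

/-- The Fourier series `û(ξ) = ∑ₖ u(k) e^{-ikξ}` of a finitely supported sequence `u` on `ℤ`
(with scalar, row vector or matrix values). -/
def symbol {M : Type*} [AddCommGroup M] [Module ℂ M] (u : ℤ →₀ M) (ξ : ℝ) : M :=
  u.sum fun k x => Complex.exp (-(Complex.I * (k : ℂ) * (ξ : ℂ))) • x

/-- The Fourier transform `f̂(ξ) = ∫ f(x) e^{-iξx} dx`. -/
def fourierTransform {E : Type*} [NormedAddCommGroup E] [NormedSpace ℂ E]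
    (f : ℝ → E) (ξ : ℝ) : E :=
  ∫ x : ℝ, Complex.exp (-(Complex.I * (ξ : ℂ) * (x : ℂ))) • f x

/-- The vector subdivision operator `(S_a v)(j) = 2 ∑ₖ v(k) a(j - 2k)` on all sequences of
`s × r` matrices; only finitely many terms are nonzero, since `a` is finitely supported. -/
def subdivision {s r : ℕ} (a : ℤ →₀ Matrix (Fin r) (Fin r) ℂ)
    (v : ℤ → Matrix (Fin s) (Fin r) ℂ) : ℤ → Matrix (Fin s) (Fin r) ℂ :=
  fun j => (2 : ℂ) • ∑ᶠ k : ℤ, v k * a (j - 2 * k)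

/-- `D = diag(1, 2⁻¹, …, 2^{1-r})`. -/
def dilationMatrix (r : ℕ) : Matrix (Fin r) (Fin r) ℂ :=
  Matrix.diagonal fun l => (2 : ℂ)⁻¹ ^ (l : ℕ)

/-- The Hermite refinements `w_n = (S_a^n w₀) D^{-n}`. -/
def refinement {s r : ℕ} (a : ℤ →₀ Matrix (Fin r) (Fin r) ℂ)
    (w₀ : ℤ → Matrix (Fin s) (Fin r) ℂ) (n : ℕ) : ℤ → Matrix (Fin s) (Fin r) ℂ :=
  fun k => ((subdivision a)^[n] w₀) k * (dilationMatrix r)⁻¹ ^ n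

/-- The Hermite subdivision scheme of order `r` with mask `a` is convergent with limiting
functions in `C^m`: for every input sequence of row vectors there is a `C^m` function `η` such that
`w_n(k) - [η(2^{-n}k), η'(2^{-n}k), …, η^{(r-1)}(2^{-n}k)]` tends to `0` uniformly for
`k ∈ ℤ ∩ [-2^n K, 2^n K]`, for every `K > 0`. -/
def IsConvergent {r : ℕ} (a : ℤ →₀ Matrix (Fin r) (Fin r) ℂ) (m : ℕ) : Prop :=
  ∀ w₀ : ℤ → Matrix (Fin 1) (Fin r) ℂ, ∃ η : ℝ → ℂ, ContDiff ℝ m η ∧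
    ∀ K : ℝ, 0 < K → ∀ ε : ℝ, 0 < ε → ∃ N : ℕ, ∀ n : ℕ, N ≤ n →
      ∀ k : ℤ, |(k : ℝ)| ≤ 2 ^ n * K → ∀ l : Fin r,
        ‖refinement a w₀ n k 0 l - iteratedDeriv (l : ℕ) η ((k : ℝ) / 2 ^ n)‖ < ε

/-- The sequence `δ I_r`, with value the identity matrix at `0` and zero elsewhere. -/
def diracIdentity (r : ℕ) : ℤ → Matrix (Fin r) (Fin r) ℂ :=
  fun k => if k = 0 then 1 else 0

/-- `φ = (φ₁, …, φ_r)ᵀ` is the basis vector function: a compactly supported `C^m` function with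
`‖(S_a^n (δ I_r))(·) D^{-n} - [φ, φ', …, φ^{(r-1)}](2^{-n} ·)‖_{ℓ_∞} → 0`. -/
def IsBasisVectorFunction {r : ℕ} (a : ℤ →₀ Matrix (Fin r) (Fin r) ℂ) (m : ℕ)
    (φ : ℝ → Fin r → ℂ) : Prop :=
  ContDiff ℝ m φ ∧ HasCompactSupport φ ∧
    ∀ ε : ℝ, 0 < ε → ∃ N : ℕ, ∀ n : ℕ, N ≤ n → ∀ k : ℤ, ∀ i l : Fin r,
      ‖refinement a (diracIdentity r) n k i l
        - iteratedDeriv (l : ℕ) φ ((k : ℝ) / 2 ^ n) i‖ < ε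

/-- The mask `a` has order `M` sum rules with respect to the matching filter `υ`:
`υ̂(0) ≠ 0`, `υ̂(2ξ) â(ξ) = υ̂(ξ) + O(|ξ|^M)` and `υ̂(2ξ) â(ξ + π) = O(|ξ|^M)` as `ξ → 0`
(entry by entry). -/
def HasSumRules {r : ℕ} (a : ℤ →₀ Matrix (Fin r) (Fin r) ℂ) (M : ℕ)
    (υ : ℤ →₀ Matrix (Fin 1) (Fin r) ℂ) : Prop :=
  symbol υ 0 ≠ 0 ∧
  (∀ l : Fin r, (fun ξ : ℝ => (symbol υ (2 * ξ) * symbol a ξ) 0 l - symbol υ ξ 0 l)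
      =O[𝓝 0] fun ξ : ℝ => |ξ| ^ M) ∧
  (∀ l : Fin r, (fun ξ : ℝ => (symbol υ (2 * ξ) * symbol a (ξ + Real.pi)) 0 l)
      =O[𝓝 0] fun ξ : ℝ => |ξ| ^ M)

/-- `υ̂(ξ) = (1 + O(|ξ|), iξ + O(|ξ|²), …, (iξ)^{r-1} + O(|ξ|^r))` as `ξ → 0`. -/
def HasHermiteLeadingTerms {r : ℕ} (υ : ℤ →₀ Matrix (Fin 1) (Fin r) ℂ) : Prop :=
  ∀ l : Fin r, (fun ξ : ℝ => symbol υ ξ 0 l - (Complex.I * (ξ : ℂ)) ^ (l : ℕ))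
      =O[𝓝 0] fun ξ : ℝ => |ξ| ^ ((l : ℕ) + 1)

/-- `υ̂(ξ) = (ĉ₁(ξ), iξ ĉ₂(ξ), …, (iξ)^{r-1} ĉ_r(ξ)) + O(|ξ|^M)` as `ξ → 0` for some finitely
supported `c₁, …, c_r` with `ĉ₁(0) = ⋯ = ĉ_r(0) = 1`. -/
def HasHermiteForm {r : ℕ} (υ : ℤ →₀ Matrix (Fin 1) (Fin r) ℂ) (M : ℕ) : Prop :=
  ∃ c : Fin r → (ℤ →₀ ℂ), (∀ l : Fin r, symbol (c l) 0 = 1) ∧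
    ∀ l : Fin r,
      (fun ξ : ℝ => symbol υ ξ 0 l - (Complex.I * (ξ : ℂ)) ^ (l : ℕ) * symbol (c l) ξ)
        =O[𝓝 0] fun ξ : ℝ => |ξ| ^ M

/-- The ordered product `â(2⁻¹ξ) â(2⁻²ξ) ⋯ â(2^{-n}ξ)`. -/
def symbolProduct {r : ℕ} (a : ℤ →₀ Matrix (Fin r) (Fin r) ℂ) (ξ : ℝ) (n : ℕ) :
    Matrix (Fin r) (Fin r) ℂ :=
  ((List.range n).map fun j => symbol a (ξ / 2 ^ (j + 1))).prod

end

end HermiteSubdivision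

/-! Every assertion concerns Taylor coefficients, so symbols and Fourier transforms are handled as
formal power series about a base point c. Put Π_n(ξ) = â(ξ/2)⋯â(ξ/2ⁿ). Column l of Π_n times 2^{nl}
(l = 0, …, r-1) is a dyadic Riemann sum for the Fourier integral of φ^{(l)}, so its Taylor
coefficients at any point converge to those of (iξ)^l φ̂(ξ) (`tendsto_coeff_iterateSeries`). Hence
Π_n(ξ) → φ̂(ξ)e₁ᵀ, which is the infinite product. Put into φ̂(ξ) = Π_n(ξ)φ̂(ξ/2ⁿ) at a point with
φ̂(ξ) ≠ 0, it forces e₁ᵀφ̂(0) = 1. At ξ = 0 it says that â(0)ⁿ tends to a rank-one projection, so 1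
is a simple eigenvalue.

Smoothness enters as φ̂(ξ) = o(|ξ|^{-m}), also for Taylor coefficients. If yâ(0) = μy, periodicity
of â gives y·φ̂(2ⁿ2πk) = μⁿ y·φ̂(2πk); by the first spanning hypothesis some k makes y·φ̂(2πk)
nonzero, whence |μ| < 2^{-m} if μ ≠ 1 (`norm_eigenvalue_lt`). So I - 2^j â(0) is invertible for 1 ≤
j ≤ m, and υ̂(2ξ)â(ξ) = υ̂(ξ) + O(|ξ|^{m+1}) is solved order by order from υ̂(0) = e₁ᵀ
(`exists_matchingJet`).

The pairing υ̂(ξ)φ̂(ξ + 2πk) is self-similar under k ↦ 2k. Decay makes it O(|ξ|^{m+1}) for k ≠ 0,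
and for k = 0 it is 1 + O(|ξ|^{m+1}). Odd frequencies give υ̂(2ξ)â(ξ+π)φ̂(ξ+π+2πk) = O(|ξ|^{m+1})
for all k, and the second spanning hypothesis removes φ̂: this is the sum rule at π. Finally υ̂Π_n
telescopes to υ̂(2^{-n}ξ) up to O(|ξ|^{m+1}), while column l of υ̂Π_n times 2^{nl} tends to (iξ)^l
up to the same order; comparing the two gives the Hermite form (`coeff_matchingJet`). -/

namespace HermiteSubdivision

noncomputable section

open PowerSeries MeasureTheory

/-! ### Formal Taylor series of exponentials and symbols. -/

/-- The Taylor series at `ξ = c` of the function `ξ ↦ e^{-iξx}`. -/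
def expKernel (c x : ℝ) : ℂ⟦X⟧ :=
  C (Complex.exp (-(Complex.I * c * x))) * rescale (-(Complex.I * x)) (exp ℂ)

theorem coeff_expKernel (c x : ℝ) (j : ℕ) :
    coeff j (expKernel c x) =
      Complex.exp (-(Complex.I * c * x)) * ((-(Complex.I * x)) ^ j / j.factorial) := by
  simp [expKernel, coeff_C_mul, coeff_rescale, coeff_exp, div_eq_mul_inv]

theorem expKernel_add (c x y : ℝ) : expKernel c (x + y) = expKernel c x * expKernel c y := by
  unfold expKernel
  rw [mul_mul_mul_comm, exp_mul_exp_eq_exp_add, ← map_mul, ← Complex.exp_add]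
  congr 3 <;> push_cast <;> ring

theorem rescale_expKernel (c x t : ℝ) :
    rescale (t : ℂ) (expKernel (t * c) x) = expKernel c (t * x) := by
  ext j
  rw [coeff_rescale, coeff_expKernel, coeff_expKernel]
  push_cast
  rw [show -(Complex.I * (t * x)) = (t : ℂ) * (-(Complex.I * x)) by ring, mul_pow,
    show -(Complex.I * (t * c) * x) = -(Complex.I * c * (t * x)) by ring]
  ring

/-- The matrix of the Taylor series at `ξ = c` of `ξ ↦ ∑ₖ u(k) e^{-iξqk}`. -/
def symbolSeries {s r : ℕ} (c q : ℝ) :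
    (ℤ →₀ Matrix (Fin s) (Fin r) ℂ) →ₗ[ℂ] Matrix (Fin s) (Fin r) ℂ⟦X⟧ :=
  Finsupp.lsum ℂ fun k =>
    { toFun := fun x => Matrix.of fun i l => C (x i l) * expKernel c (q * k)
      map_add' := fun x y => by ext1 i l; simp [add_mul]
      map_smul' := fun t x => by
        ext1 i l
        simp [mul_assoc, PowerSeries.smul_eq_C_mul] }

theorem symbolSeries_apply {s r : ℕ} (c q : ℝ) (u : ℤ →₀ Matrix (Fin s) (Fin r) ℂ)
    (i : Fin s) (l : Fin r) :
    symbolSeries c q u i l = u.sum fun k x => C (x i l) * expKernel c (q * k) := by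
  simp [symbolSeries, Finsupp.sum, Matrix.sum_apply]

theorem symbolSeries_single {s r : ℕ} (c q : ℝ) (k : ℤ) (x : Matrix (Fin s) (Fin r) ℂ) :
    symbolSeries c q (Finsupp.single k x) =
      Matrix.of fun i l => C (x i l) * expKernel c (q * k) := by
  ext1 i l
  rw [symbolSeries_apply, Finsupp.sum_single_index (by simp), Matrix.of_apply]

theorem coeff_symbolSeries {s r : ℕ} (c q : ℝ) (u : ℤ →₀ Matrix (Fin s) (Fin r) ℂ)
    (i : Fin s) (l : Fin r) (j : ℕ) :
    coeff j (symbolSeries c q u i l) = u.sum fun k x => x i l * coeff j (expKernel c (q * k)) := by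
  simp [symbolSeries_apply, Finsupp.sum, map_sum, coeff_C_mul]

theorem symbol_apply {s r : ℕ} (u : ℤ →₀ Matrix (Fin s) (Fin r) ℂ) (ξ : ℝ)
    (i : Fin s) (l : Fin r) :
    symbol u ξ i l = u.sum fun k x => Complex.exp (-(Complex.I * k * ξ)) * x i l := by
  simp [symbol, Finsupp.sum, Matrix.sum_apply]

theorem constantCoeff_symbolSeries {s r : ℕ} (c q : ℝ) (u : ℤ →₀ Matrix (Fin s) (Fin r) ℂ)
    (i : Fin s) (l : Fin r) :
    constantCoeff (symbolSeries c q u i l) = symbol u (q * c) i l := by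
  rw [← coeff_zero_eq_constantCoeff_apply, coeff_symbolSeries, symbol_apply]
  refine Finsupp.sum_congr fun k _ => ?_
  rw [coeff_expKernel, mul_comm]
  simp only [pow_zero, Nat.factorial_zero, Nat.cast_one, div_one, mul_one]
  congr 2
  push_cast; ring

theorem symbolSeries_map_rescale {s r : ℕ} (c q t : ℝ) (u : ℤ →₀ Matrix (Fin s) (Fin r) ℂ) :
    (symbolSeries (t * c) q u).map (rescale (t : ℂ)) = symbolSeries c (t * q) u := by
  ext1 i l
  rw [Matrix.map_apply, symbolSeries_apply, symbolSeries_apply, map_finsuppSum]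
  refine Finsupp.sum_congr fun k _ => ?_
  rw [map_mul, rescale_expKernel, mul_assoc]
  congr 1
  ext j; rcases j with _ | j <;> simp [coeff_rescale, coeff_C]

/-- Translating the base point by an element of `2πℤ` does not change the Taylor series of a
symbol. -/
theorem symbolSeries_add_two_pi {s r : ℕ} (c : ℝ) (n : ℤ) (u : ℤ →₀ Matrix (Fin s) (Fin r) ℂ) :
    symbolSeries (c + 2 * Real.pi * n) 1 u = symbolSeries c 1 u := by
  ext i l j
  rw [coeff_symbolSeries, coeff_symbolSeries]
  refine Finsupp.sum_congr fun k _ => ?_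
  rw [coeff_expKernel, coeff_expKernel]
  congr 2
  rw [Complex.exp_eq_exp_iff_exists_int]
  exact ⟨-(n * k), by push_cast; ring⟩

/-! ### From formal series to asymptotics. -/

/-- `p` is the Taylor series at `0` of the entire function `f`. -/
def HasExpansion (f : ℝ → ℂ) (p : ℂ⟦X⟧) : Prop :=
  ∀ ξ : ℝ, (Summable fun j => ‖coeff j p * (ξ : ℂ) ^ j‖) ∧ f ξ = ∑' j, coeff j p * (ξ : ℂ) ^ j

namespace HasExpansion

theorem add {f g : ℝ → ℂ} {p q : ℂ⟦X⟧} (hf : HasExpansion f p) (hg : HasExpansion g q) :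
    HasExpansion (fun ξ => f ξ + g ξ) (p + q) := fun ξ => by
  obtain ⟨h1, h2⟩ := hf ξ
  obtain ⟨h3, h4⟩ := hg ξ
  simp only [map_add, add_mul]
  exact ⟨(h1.add h3).of_nonneg_of_le (fun _ => norm_nonneg _) fun _ => norm_add_le _ _,
    by rw [h1.of_norm.tsum_add h3.of_norm, h2, h4]⟩

theorem mul {f g : ℝ → ℂ} {p q : ℂ⟦X⟧} (hf : HasExpansion f p) (hg : HasExpansion g q) :
    HasExpansion (fun ξ => f ξ * g ξ) (p * q) := fun ξ => by
  obtain ⟨h1, h2⟩ := hf ξ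
  obtain ⟨h3, h4⟩ := hg ξ
  have key : ∀ n, coeff n (p * q) * (ξ : ℂ) ^ n = ∑ kl ∈ Finset.HasAntidiagonal.antidiagonal n,
      (coeff kl.1 p * (ξ : ℂ) ^ kl.1) * (coeff kl.2 q * (ξ : ℂ) ^ kl.2) := fun n => by
    rw [coeff_mul, Finset.sum_mul]
    refine Finset.sum_congr rfl fun kl hkl => ?_
    rw [← Finset.HasAntidiagonal.mem_antidiagonal.1 hkl, pow_add]; ring
  have h5 := summable_norm_sum_mul_antidiagonal_of_summable_norm h1 h3
  have h6 := tsum_mul_tsum_eq_tsum_sum_antidiagonal_of_summable_norm h1 h3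
  simp only [← key] at h5 h6
  exact ⟨h5, by rw [← h6, ← h2, ← h4]⟩

theorem const (z : ℂ) : HasExpansion (fun _ => z) (C z) := fun ξ => by
  have key : ∀ j, j ≠ 0 → coeff j (C z) * (ξ : ℂ) ^ j = 0 := fun j hj => by simp [coeff_C, hj]
  refine ⟨summable_of_ne_finset_zero (s := {0}) fun j hj => ?_, ?_⟩
  · rw [key j (by simpa using hj), norm_zero]
  · rw [tsum_eq_single 0 key]; simp

theorem id : HasExpansion (fun ξ => (ξ : ℂ)) X := fun ξ => by
  have key : ∀ j, j ≠ 1 → coeff j (X : ℂ⟦X⟧) * (ξ : ℂ) ^ j = 0 := fun j hj => by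
    simp [coeff_X, hj]
  refine ⟨summable_of_ne_finset_zero (s := {1}) fun j hj => ?_, ?_⟩
  · rw [key j (by simpa using hj), norm_zero]
  · rw [tsum_eq_single 1 key]; simp

theorem pow {f : ℝ → ℂ} {p : ℂ⟦X⟧} (hf : HasExpansion f p) (n : ℕ) :
    HasExpansion (fun ξ => f ξ ^ n) (p ^ n) := by
  induction n with
  | zero => simpa using const 1
  | succ n ih => simpa only [pow_succ] using ih.mul hf

theorem sub {f g : ℝ → ℂ} {p q : ℂ⟦X⟧} (hf : HasExpansion f p) (hg : HasExpansion g q) :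
    HasExpansion (fun ξ => f ξ - g ξ) (p - q) := by
  have := hf.add ((const (-1)).mul hg)
  simpa [sub_eq_add_neg] using this

theorem sum {ι : Type*} (s : Finset ι) {f : ι → ℝ → ℂ} {p : ι → ℂ⟦X⟧}
    (h : ∀ i ∈ s, HasExpansion (f i) (p i)) :
    HasExpansion (fun ξ => ∑ i ∈ s, f i ξ) (∑ i ∈ s, p i) := by
  classical
  induction s using Finset.induction_on with
  | empty => simpa using const 0
  | insert i s hi ih =>
    simp only [Finset.sum_insert hi]
    exact (h i (by simp)).add (ih fun k hk => h k (by simp [hk]))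

theorem exp_mul (t : ℂ) :
    HasExpansion (fun ξ => Complex.exp (t * ξ)) (rescale t (exp ℂ)) := fun ξ => by
  have key : ∀ j, coeff j (rescale t (exp ℂ)) * (ξ : ℂ) ^ j = (t * ξ) ^ j / j.factorial :=
    fun j => by simp [coeff_rescale, coeff_exp, mul_pow]; ring
  simp only [key]
  refine ⟨NormedSpace.norm_expSeries_div_summable (t * ξ : ℂ), ?_⟩
  rw [Complex.exp_eq_exp_ℂ, NormedSpace.exp_eq_tsum_div]

theorem comp_mul {f : ℝ → ℂ} {p : ℂ⟦X⟧} (hf : HasExpansion f p) (t : ℝ) :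
    HasExpansion (fun ξ => f (t * ξ)) (rescale (t : ℂ) p) := fun ξ => by
  obtain ⟨h1, h2⟩ := hf (t * ξ)
  have key : ∀ j, coeff j (rescale (t : ℂ) p) * (ξ : ℂ) ^ j
      = coeff j p * ((t * ξ : ℝ) : ℂ) ^ j := fun j => by
    rw [coeff_rescale]; push_cast; rw [mul_pow]; ring
  simp only [key]
  exact ⟨h1, h2⟩

/-- For |ξ| < 1 every surviving term has degree at least M, so |ξ|^M factors out of the sum of the
absolute values of the coefficients. -/
theorem isBigO {f : ℝ → ℂ} {p : ℂ⟦X⟧} (hf : HasExpansion f p) {M : ℕ} (h : X ^ M ∣ p) :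
    f =O[𝓝 0] fun ξ : ℝ => |ξ| ^ M := by
  rw [X_pow_dvd_iff] at h
  have h1 := (hf 1).1
  simp only [Complex.ofReal_one, one_pow, mul_one] at h1
  refine IsBigO.of_bound (∑' j, ‖coeff j p‖) ?_
  filter_upwards [Metric.ball_mem_nhds (0 : ℝ) one_pos] with ξ hξ
  rw [mem_ball_zero_iff, Real.norm_eq_abs] at hξ
  obtain ⟨h2, h3⟩ := hf ξ
  rw [h3, norm_pow, Real.norm_eq_abs, abs_abs, ← tsum_mul_right]
  refine (norm_tsum_le_tsum_norm h2).trans (h2.tsum_le_tsum (fun j => ?_) (h1.mul_right _))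
  rcases lt_or_ge j M with hj | hj
  · rw [h j hj]; simp
  · rw [norm_mul, norm_pow, Complex.norm_real, Real.norm_eq_abs]
    exact mul_le_mul_of_nonneg_left (pow_le_pow_of_le_one (abs_nonneg _) hξ.le hj) (norm_nonneg _)

end HasExpansion

theorem hasExpansion_symbol {s r : ℕ} (c : ℝ) (u : ℤ →₀ Matrix (Fin s) (Fin r) ℂ)
    (i : Fin s) (l : Fin r) :
    HasExpansion (fun ξ => symbol u (ξ + c) i l) (symbolSeries c 1 u i l) := by
  simp only [symbol_apply, symbolSeries_apply, Finsupp.sum]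
  refine HasExpansion.sum _ fun k _ => ?_
  have := (HasExpansion.const (u k i l * Complex.exp (-(Complex.I * c * (1 * k : ℝ))))).mul
    (HasExpansion.exp_mul (-(Complex.I * (1 * k : ℝ))))
  convert! this using 1
  · ext ξ
    rw [mul_assoc (u k i l), ← Complex.exp_add, mul_comm (u k i l)]
    congr 2
    push_cast; ring
  · rw [expKernel, map_mul, ← mul_assoc]

/-! ### Trigonometric polynomials with a prescribed jet. -/

/-- Every finite jet is the jet of a trigonometric polynomial. -/
theorem exists_jet (M : ℕ) (t : ℕ → ℂ) :
    ∃ u : Fin M → ℂ, ∀ j < M, ∑ k : Fin M, u k * coeff j (expKernel 0 (k : ℕ)) = t j := by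
  -- The jth coefficient at node k is (-ik)^j / j!, so after clearing factorials the system is
  -- Vandermonde with distinct nodes.
  have hdet : (Matrix.vandermonde fun k : Fin M => -(Complex.I * (k : ℕ))).det ≠ 0 := by
    rw [Matrix.det_vandermonde_ne_zero_iff]
    intro x y h
    simpa [Fin.val_inj] using h
  have hu : IsUnit (Matrix.vandermonde fun k : Fin M => -(Complex.I * ((k : ℕ) : ℂ))) :=
    (Matrix.isUnit_iff_isUnit_det _).2 (isUnit_iff_ne_zero.2 hdet)
  obtain ⟨u, hu⟩ := (Matrix.vecMul_surjective_iff_isUnit.2 hu) fun j => t j * (j : ℕ).factorial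
  refine ⟨u, fun j hj => ?_⟩
  have := congrFun hu ⟨j, hj⟩
  simp only [Matrix.vecMul, dotProduct, Matrix.vandermonde_apply] at this
  rw [eq_comm, ← mul_left_inj' (Nat.cast_ne_zero.2 j.factorial_ne_zero : (j.factorial : ℂ) ≠ 0),
    ← this, Finset.sum_mul]
  refine Finset.sum_congr rfl fun k _ => ?_
  rw [coeff_expKernel]
  have : (j.factorial : ℂ) ≠ 0 := Nat.cast_ne_zero.2 j.factorial_ne_zero
  field_simp
  simp

theorem exists_symbolSeries_jet {s r : ℕ} (M : ℕ) (t : ℕ → Matrix (Fin s) (Fin r) ℂ) :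
    ∃ u : ℤ →₀ Matrix (Fin s) (Fin r) ℂ,
      ∀ j < M, ∀ i l, coeff j (symbolSeries 0 1 u i l) = t j i l := by
  choose u hu using fun i l => exists_jet M fun j => t j i l
  refine ⟨∑ k : Fin M, Finsupp.single ((k : ℕ) : ℤ) (Matrix.of fun i l => u i l k),
    fun j hj i l => ?_⟩
  rw [map_sum, Matrix.sum_apply, map_sum, ← hu i l j hj]
  refine Finset.sum_congr rfl fun k _ => ?_
  rw [symbolSeries_single]
  simp [coeff_C_mul]

/-! ### Iterated masks and products of symbols. -/

/-- The sequence `j ↦ ∑ₖ u(k) v(j - 2k)`. -/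
def upsampleConv {s r t : ℕ} (u : ℤ →₀ Matrix (Fin s) (Fin r) ℂ)
    (v : ℤ →₀ Matrix (Fin r) (Fin t) ℂ) : ℤ →₀ Matrix (Fin s) (Fin t) ℂ :=
  u.sum fun k x => v.sum fun l y => Finsupp.single (l + 2 * k) (x * y)

theorem upsampleConv_apply {s r t : ℕ} (u : ℤ →₀ Matrix (Fin s) (Fin r) ℂ)
    (v : ℤ →₀ Matrix (Fin r) (Fin t) ℂ) (j : ℤ) :
    upsampleConv u v j = u.sum fun k x => x * v (j - 2 * k) := by
  rw [upsampleConv, Finsupp.sum_apply]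
  refine Finsupp.sum_congr fun k _ => ?_
  rw [Finsupp.sum_apply, Finsupp.sum, Finset.sum_eq_single (j - 2 * k)]
  · simp
  · intro l _ hl
    rw [Finsupp.single_apply, if_neg (by omega)]
  · intro h
    rw [Finsupp.notMem_support_iff.1 h]; simp

/-- On the Fourier side this is û(2ξ)v̂(ξ): the exponential at p + 2k splits into those at 2k and at
p. -/
theorem symbolSeries_upsampleConv {s r t : ℕ} (c q : ℝ) (u : ℤ →₀ Matrix (Fin s) (Fin r) ℂ)
    (v : ℤ →₀ Matrix (Fin r) (Fin t) ℂ) :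
    symbolSeries c q (upsampleConv u v) = symbolSeries c (q * 2) u * symbolSeries c q v := by
  ext1 i l
  rw [Matrix.mul_apply]
  simp only [symbolSeries_apply c (q * 2), symbolSeries_apply c q v]
  simp only [upsampleConv, Finsupp.sum, map_sum, Matrix.sum_apply, symbolSeries_single,
    Matrix.of_apply, Matrix.mul_apply, Finset.sum_mul_sum]
  refine Eq.symm (Finset.sum_comm.trans (Finset.sum_congr rfl fun k _ => ?_))
  refine Finset.sum_comm.trans (Finset.sum_congr rfl fun p _ => ?_)
  rw [Finset.sum_mul]
  refine Finset.sum_congr rfl fun b _ => ?_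
  rw [map_mul, show q * ((p + 2 * k : ℤ) : ℝ) = q * 2 * k + q * p by push_cast; ring,
    expKernel_add]
  ring

/-- The sequence `S_aⁿ (δ I_r)`, as a finitely supported function. -/
def maskIterate {r : ℕ} (a : ℤ →₀ Matrix (Fin r) (Fin r) ℂ) :
    ℕ → (ℤ →₀ Matrix (Fin r) (Fin r) ℂ)
  | 0 => Finsupp.single 0 1
  | n + 1 => (2 : ℂ) • upsampleConv (maskIterate a n) a

theorem subdivision_coe {s r : ℕ} (a : ℤ →₀ Matrix (Fin r) (Fin r) ℂ)
    (u : ℤ →₀ Matrix (Fin s) (Fin r) ℂ) :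
    subdivision a ⇑u = ⇑((2 : ℂ) • upsampleConv u a) := by
  ext1 j
  rw [Finsupp.smul_apply, upsampleConv_apply, subdivision, Finsupp.sum]
  congr 1
  refine finsum_eq_sum_of_support_subset _ fun k hk => ?_
  rw [Finset.mem_coe, Finsupp.mem_support_iff]
  intro h
  exact hk (by simp [h])

theorem subdivision_iterate {r : ℕ} (a : ℤ →₀ Matrix (Fin r) (Fin r) ℂ) (n : ℕ) :
    (subdivision a)^[n] (diracIdentity r) = ⇑(maskIterate a n) := by
  induction n with
  | zero =>
    ext1 k
    simp [diracIdentity, maskIterate, Finsupp.single_apply, eq_comm]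
  | succ n ih => rw [Function.iterate_succ_apply', ih, subdivision_coe, maskIterate]

theorem dilationMatrix_inv_pow (r n : ℕ) :
    (dilationMatrix r)⁻¹ ^ n = Matrix.diagonal fun l : Fin r => (2 : ℂ) ^ (n * (l : ℕ)) := by
  have : (dilationMatrix r)⁻¹ = Matrix.diagonal fun l : Fin r => (2 : ℂ) ^ (l : ℕ) := by
    refine Matrix.inv_eq_right_inv ?_
    rw [dilationMatrix, Matrix.diagonal_mul_diagonal, ← Matrix.diagonal_one]
    congr 1; ext l
    rw [← mul_pow]; norm_num
  rw [this, Matrix.diagonal_pow]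
  congr 1; ext l
  simp [← pow_mul, mul_comm]

theorem refinement_dirac_apply {r : ℕ} (a : ℤ →₀ Matrix (Fin r) (Fin r) ℂ) (n : ℕ) (k : ℤ)
    (i l : Fin r) :
    refinement a (diracIdentity r) n k i l = maskIterate a n k i l * 2 ^ (n * (l : ℕ)) := by
  rw [refinement, subdivision_iterate, dilationMatrix_inv_pow, Matrix.mul_diagonal]

theorem maskIterate_eq_zero {r : ℕ} {a : ℤ →₀ Matrix (Fin r) (Fin r) ℂ} {K : ℤ}
    (hK : ∀ k : ℤ, K < |k| → a k = 0) (hK0 : 0 ≤ K) (n : ℕ) {k : ℤ} (hk : 2 ^ n * K < |k|) :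
    maskIterate a n k = 0 := by
  -- The support radius obeys R ↦ 2R + K from R = 0, that is R = (2ⁿ - 1)K; the weaker bound 2ⁿK is
  -- not preserved by this recursion.
  suffices H : ∀ k : ℤ, (2 ^ n - 1) * K < |k| → maskIterate a n k = 0 from
    H k (by nlinarith)
  clear hk k
  induction n with
  | zero =>
    intro k hk
    have : (0 : ℤ) ≠ k := by rintro rfl; simp at hk
    simp [maskIterate, this]
  | succ n ih =>
    intro k hk
    rw [maskIterate, Finsupp.smul_apply, upsampleConv_apply, Finsupp.sum,
      Finset.sum_eq_zero, smul_zero]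
    intro p _
    by_cases hp : (2 ^ n - 1) * K < |p|
    · rw [ih p hp, zero_mul]
    · rw [hK, mul_zero]
      rw [pow_succ] at hk
      have h1 : |k| ≤ |k - 2 * p| + 2 * |p| := by
        rcases abs_cases k with h | h <;> rcases abs_cases (k - 2 * p) with h' | h' <;>
          rcases abs_cases p with h'' | h'' <;> omega
      push Not at hp
      nlinarith

/-- The defining recursion appends a finest-scale factor on the right; this form splits off the
coarsest factor on the left, as the refinement equation requires. Both describe the same product, by
associativity. -/
theorem maskIterate_succ_apply {r : ℕ} (a : ℤ →₀ Matrix (Fin r) (Fin r) ℂ) (n : ℕ) (j : ℤ) :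
    maskIterate a (n + 1) j =
      (2 : ℂ) • a.sum fun l y => y * maskIterate a n (j - 2 ^ n * l) := by
  have step : ∀ n (j : ℤ), maskIterate a (n + 1) j =
      (2 : ℂ) • ∑ᶠ k : ℤ, maskIterate a n k * a (j - 2 * k) := fun n j =>
    (congrFun (subdivision_coe a (maskIterate a n)) j).symm
  induction n generalizing j with
  | zero =>
    rw [step, finsum_eq_single _ 0]
    · congr 1
      rw [Finsupp.sum, Finset.sum_eq_single j]
      · simp [maskIterate]
      · intro l _ hl
        have : (0 : ℤ) ≠ j - 2 ^ 0 * l := by simp; omega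
        simp only [maskIterate]
        rw [Finsupp.single_eq_of_ne this.symm, mul_zero]
      · intro h
        rw [Finsupp.notMem_support_iff.1 h, zero_mul]
    · intro k hk
      simp [maskIterate, hk]
  | succ n ih =>
    rw [step]
    congr 1
    have hfin : ∀ l : ℤ, (Function.support fun k : ℤ =>
        (2 : ℂ) • (a l * maskIterate a n (k - 2 ^ n * l) * a (j - 2 * k))).Finite := fun l => by
      have hinj : Function.Injective fun k : ℤ => j - 2 * k := fun x y h => by
        simp only at h; omega
      refine (a.hasFiniteSupport.preimage hinj.injOn).subset fun k hk => ?_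
      simp only [Set.mem_preimage, Function.mem_support]
      intro h
      exact hk (by simp [h])
    calc ∑ᶠ k : ℤ, maskIterate a (n + 1) k * a (j - 2 * k)
        = ∑ᶠ k : ℤ, ∑ l ∈ a.support,
            (2 : ℂ) • (a l * maskIterate a n (k - 2 ^ n * l) * a (j - 2 * k)) := by
          refine finsum_congr fun k => ?_
          rw [ih, Finsupp.sum, smul_mul_assoc, Finset.sum_mul, Finset.smul_sum]
      _ = ∑ l ∈ a.support, ∑ᶠ k : ℤ,
            (2 : ℂ) • (a l * maskIterate a n (k - 2 ^ n * l) * a (j - 2 * k)) :=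
          finsum_sum_comm _ _ fun l _ => hfin l
      _ = a.sum fun l y => y * maskIterate a (n + 1) (j - 2 ^ (n + 1) * l) := by
          refine Finset.sum_congr rfl fun l _ => ?_
          simp only
          rw [step, mul_smul_comm, ← smul_finsum' _ (by
            refine (hfin l).subset fun k hk => ?_
            simpa [mul_assoc] using hk)]
          congr 1
          rw [← finsum_comp_equiv (Equiv.addRight (2 ^ n * l))]
          rw [mul_finsum' _ _ ?_]
          · refine finsum_congr fun k => ?_
            rw [mul_assoc]
            simp only [Equiv.coe_addRight, add_sub_cancel_right]
            congr 3
            ring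
          · refine (maskIterate a n).hasFiniteSupport.subset fun k hk => ?_
            intro h
            exact hk (by simp [h])

/-- The Taylor series at `ξ = c` of `â(ξ/2) ⋯ â(ξ/2ⁿ)`. -/
def iterateSeries {r : ℕ} (a : ℤ →₀ Matrix (Fin r) (Fin r) ℂ) (c : ℝ) (n : ℕ) :
    Matrix (Fin r) (Fin r) ℂ⟦X⟧ :=
  ((2 : ℂ)⁻¹ ^ n) • symbolSeries c ((2 : ℝ)⁻¹ ^ n) (maskIterate a n)

theorem iterateSeries_zero {r : ℕ} (a : ℤ →₀ Matrix (Fin r) (Fin r) ℂ) (c : ℝ) :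
    iterateSeries a c 0 = 1 := by
  have h0 : expKernel c 0 = 1 := by
    ext j
    rcases j with _ | j <;> simp [coeff_expKernel, coeff_one]
  ext1 i l
  rw [iterateSeries, maskIterate, symbolSeries_single]
  by_cases h : i = l <;> simp [h, h0, Matrix.one_apply]

theorem iterateSeries_succ {r : ℕ} (a : ℤ →₀ Matrix (Fin r) (Fin r) ℂ) (c : ℝ) (n : ℕ) :
    iterateSeries a c (n + 1) = iterateSeries a c n * symbolSeries c ((2 : ℝ)⁻¹ ^ (n + 1)) a := by
  rw [iterateSeries, maskIterate, map_smul, symbolSeries_upsampleConv, smul_smul,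
    iterateSeries, smul_mul_assoc]
  congr 2
  · rw [pow_succ]; ring
  · congr 2; rw [pow_succ]; ring

theorem constantCoeff_iterateSeries {r : ℕ} (a : ℤ →₀ Matrix (Fin r) (Fin r) ℂ) (ξ : ℝ) (n : ℕ)
    (i l : Fin r) :
    constantCoeff (iterateSeries a ξ n i l) = symbolProduct a ξ n i l := by
  induction n generalizing l with
  | zero => by_cases h : i = l <;> simp [iterateSeries_zero, symbolProduct, h]
  | succ n ih =>
    rw [iterateSeries_succ, symbolProduct, List.range_succ, List.map_append, List.prod_append,
      Matrix.mul_apply, map_sum]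
    rw [← symbolProduct, Matrix.mul_apply]
    refine Finset.sum_congr rfl fun p _ => ?_
    rw [map_mul, ih, constantCoeff_symbolSeries]
    simp [div_eq_mul_inv, mul_comm]

theorem symbolProduct_zero_right {r : ℕ} (a : ℤ →₀ Matrix (Fin r) (Fin r) ℂ) (n : ℕ) :
    symbolProduct a 0 n = symbol a 0 ^ n := by
  simp [symbolProduct]

/-! ### Dyadic Riemann sums. -/

/-- Riemann sums over the dyadic grids of a perturbation of a continuous compactly supported
function converge to its integral. -/
theorem tendsto_dyadic_riemannSum {G : ℝ → ℂ} (hG : Continuous G) {K : ℕ}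
    (hGK : ∀ x : ℝ, (K : ℝ) ≤ |x| → G x = 0) {F : ℕ → ℤ → ℂ}
    (h : ∀ ε : ℝ, 0 < ε → ∃ N : ℕ, ∀ n : ℕ, N ≤ n → ∀ k : ℤ, ‖F n k - G ((k : ℝ) / 2 ^ n)‖ < ε) :
    Tendsto (fun n : ℕ => (2 : ℂ)⁻¹ ^ n *
        ∑ k ∈ Finset.Ico (-(2 ^ n * K : ℤ)) (2 ^ n * K), F n k)
      atTop (𝓝 (∫ x, G x)) := by
  have hcpt : HasCompactSupport G := HasCompactSupport.of_support_subset_isCompact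
    (isCompact_Icc (a := -(K : ℝ)) (b := K)) fun x hx => by
      by_contra hx'
      refine hx (hGK x ?_)
      rw [Set.mem_Icc, ← abs_le, not_le] at hx'
      exact hx'.le
  have huc : UniformContinuous G := hcpt.uniformContinuous_of_continuous hG
  have hint : ∫ x, G x = ∫ x in (-(K : ℝ))..K, G x := by
    rw [intervalIntegral.integral_of_le (by linarith [(Nat.cast_nonneg K : (0 : ℝ) ≤ K)]),
      setIntegral_eq_integral_of_forall_compl_eq_zero]
    intro x hx
    refine hGK x ?_
    by_contra hx'
    rw [not_le, abs_lt] at hx'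
    exact hx ⟨hx'.1, hx'.2.le⟩
  have hsum : ∀ n : ℕ, ∑ k ∈ Finset.Ico (-(2 ^ n * K : ℤ)) (2 ^ n * K), F n k
      = ∑ i ∈ Finset.range (2 * (2 ^ n * K)), F n (i - 2 ^ n * K) := fun n => by
    refine (Finset.sum_nbij (fun i : ℕ => (i : ℤ) - 2 ^ n * K) ?_ ?_ ?_ ?_).symm
    · intro i hi
      simp only [Finset.mem_range, Finset.mem_Ico] at hi ⊢
      zify at hi
      constructor <;> omega
    · intro i _ j _ hij
      simp only at hij
      omega
    · intro k hk
      simp only [Finset.coe_Ico, Set.mem_Ico, Finset.coe_range, Set.mem_image,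
        Set.mem_Iio] at hk ⊢
      refine ⟨(k + 2 ^ n * K).toNat, ?_, ?_⟩
      · zify; omega
      · omega
    · intro i _; rfl
  rw [hint, Metric.tendsto_atTop]
  intro ε hε
  -- There are 2·2ⁿK cells of length 2⁻ⁿ, each with error at most 2δ per unit length, hence 4Kδ in
  -- all; the extra 1 gives strictness and allows K = 0.
  set δ : ℝ := ε / (4 * K + 1) with hδ
  have hδ0 : 0 < δ := by positivity
  obtain ⟨η, hη, huc⟩ := Metric.uniformContinuous_iff.1 huc δ hδ0
  obtain ⟨N1, hN1⟩ := h δ hδ0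
  obtain ⟨N2, hN2⟩ := exists_pow_lt_of_lt_one hη (by norm_num : (2 : ℝ)⁻¹ < 1)
  refine ⟨max N1 N2, fun n hn => ?_⟩
  have hn2 : (2 : ℝ)⁻¹ ^ n < η :=
    (pow_le_pow_of_le_one (by norm_num) (by norm_num) ((le_max_right _ _).trans hn)).trans_lt hN2
  have h2n : (0 : ℝ) < 2 ^ n := by positivity
  let t : ℕ → ℝ := fun i => ((i : ℝ) - 2 ^ n * K) / 2 ^ n
  have ht : ∀ i, t (i + 1) = t i + 2⁻¹ ^ n := fun i => by
    simp only [t]; push_cast; rw [inv_pow]; field_simp; ring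
  have hadj := intervalIntegral.sum_integral_adjacent_intervals (f := G) (μ := volume) (a := t)
    (n := 2 * (2 ^ n * K)) fun k _ => hG.intervalIntegrable _ _
  have ht0 : t 0 = -K := by simp only [t]; field_simp; simp
  have htn : t (2 * (2 ^ n * K)) = K := by simp only [t]; push_cast; field_simp; ring
  rw [ht0, htn] at hadj
  rw [← hadj, hsum, Finset.mul_sum, dist_eq_norm, ← Finset.sum_sub_distrib]
  have hpiece : ∀ i ∈ Finset.range (2 * (2 ^ n * K)),
      ‖(2 : ℂ)⁻¹ ^ n * F n ((i : ℤ) - 2 ^ n * K) - ∫ x in (t i)..(t (i + 1)), G x‖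
        ≤ 2 * δ * 2⁻¹ ^ n := by
    intro i _
    have h1 : (2 : ℂ)⁻¹ ^ n * F n ((i : ℤ) - 2 ^ n * K)
        = ∫ _ in (t i)..(t (i + 1)), F n ((i : ℤ) - 2 ^ n * K) := by
      rw [intervalIntegral.integral_const, ht, add_sub_cancel_left, Complex.real_smul]
      push_cast; rfl
    rw [h1, ← intervalIntegral.integral_sub (by simp) (hG.intervalIntegrable _ _)]
    refine (intervalIntegral.norm_integral_le_of_norm_le_const (C := 2 * δ) fun x hx => ?_).trans
      (le_of_eq ?_)
    · rw [ht, Set.uIoc_of_le (by linarith [show (0 : ℝ) < 2⁻¹ ^ n by positivity])] at hx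
      have e1 := hN1 n ((le_max_left _ _).trans hn) ((i : ℤ) - 2 ^ n * K)
      have e2 : ((((i : ℤ) - 2 ^ n * K : ℤ) : ℝ)) / 2 ^ n = t i := by simp only [t]; push_cast; rfl
      rw [e2] at e1
      have e3 : dist (G (t i)) (G x) < δ := huc (by
        rw [Real.dist_eq, abs_sub_comm, abs_of_pos (by linarith [hx.1])]
        linarith [hx.2])
      rw [dist_eq_norm] at e3
      calc _ = ‖(F n ((i : ℤ) - 2 ^ n * K) - G (t i)) + (G (t i) - G x)‖ := by
              rw [sub_add_sub_cancel]
        _ ≤ _ := (norm_add_le _ _).trans (by linarith)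
    · rw [ht, add_sub_cancel_left, abs_of_pos (by positivity)]
  calc _ ≤ ∑ i ∈ Finset.range (2 * (2 ^ n * K)), 2 * δ * 2⁻¹ ^ n :=
        (norm_sum_le _ _).trans (Finset.sum_le_sum hpiece)
    _ = 4 * K * δ := by
        rw [Finset.sum_const, Finset.card_range, nsmul_eq_mul, inv_pow]
        push_cast; field_simp; ring
    _ < (4 * K + 1) * δ := by linarith
    _ = ε := by rw [hδ]; field_simp

/-! ### Taylor series of Fourier transforms of compactly supported functions. -/

/-- The Taylor series at `ξ = c` of `f̂`, for a compactly supported function `f`. -/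
def momentSeries (c : ℝ) (f : ℝ → ℂ) : ℂ⟦X⟧ :=
  mk fun j => ∫ x, f x * coeff j (expKernel c x)

theorem coeff_momentSeries (c : ℝ) (f : ℝ → ℂ) (j : ℕ) :
    coeff j (momentSeries c f) = ∫ x, f x * coeff j (expKernel c x) := coeff_mk _ _

theorem continuous_coeff_expKernel (c : ℝ) (j : ℕ) :
    Continuous fun x => coeff j (expKernel c x) := by
  simp only [coeff_expKernel]
  fun_prop

theorem integrable_mul_coeff_expKernel {f : ℝ → ℂ} (hf : Continuous f) (hc : HasCompactSupport f)
    (c : ℝ) (j : ℕ) : Integrable fun x => f x * coeff j (expKernel c x) :=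
  (hf.mul (continuous_coeff_expKernel c j)).integrable_of_hasCompactSupport hc.mul_right

/-- Differentiating e^{-iξx} in x multiplies it by -iξ, and iξ expanded at c is ic + iX. -/
theorem hasDerivAt_coeff_expKernel (c x : ℝ) (j : ℕ) :
    HasDerivAt (fun x => coeff j (expKernel c x))
      (-coeff j ((C (Complex.I * c) + C Complex.I * X) * expKernel c x)) x := by
  have h1 : HasDerivAt (fun x : ℝ => Complex.exp (-(Complex.I * c * x)))
      (Complex.exp (-(Complex.I * c * x)) * (-(Complex.I * c * 1))) x :=
    (((hasDerivAt_id x).ofReal_comp.const_mul (Complex.I * (c : ℂ))).neg).cexp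
  have h2 : HasDerivAt (fun x : ℝ => (-(Complex.I * x)) ^ j / (j.factorial : ℂ))
      (j * (-(Complex.I * x)) ^ (j - 1) * (-(Complex.I * 1)) / (j.factorial : ℂ)) x :=
    ((((hasDerivAt_id x).ofReal_comp.const_mul Complex.I).neg).pow j).div_const _
  simp only [coeff_expKernel]
  convert! h1.mul h2 using 1
  rw [add_mul, map_add, mul_assoc (C Complex.I), coeff_C_mul, coeff_C_mul, coeff_expKernel]
  rcases j with _ | j
  · simp [coeff_zero_X_mul]; ring
  · rw [coeff_succ_X_mul, coeff_expKernel, Nat.factorial_succ]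
    have : (j.factorial : ℂ) ≠ 0 := Nat.cast_ne_zero.2 j.factorial_ne_zero
    have : (j : ℂ) + 1 ≠ 0 := by exact_mod_cast j.succ_ne_zero
    push_cast
    field_simp
    ring

theorem coeff_linear_mul (a b : ℂ) (p : ℂ⟦X⟧) (j : ℕ) :
    coeff j ((C a + C b * X) * p) =
      a * coeff j p + b * (if j = 0 then 0 else coeff (j - 1) p) := by
  rw [add_mul, map_add, mul_assoc (C b), coeff_C_mul, coeff_C_mul]
  rcases j with _ | j
  · simp [coeff_zero_X_mul]
  · simp [coeff_succ_X_mul]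

theorem coeff_linear_mul_momentSeries {f : ℝ → ℂ} (hf : Continuous f) (hc : HasCompactSupport f)
    (c : ℝ) (a b : ℂ) (j : ℕ) :
    coeff j ((C a + C b * X) * momentSeries c f) =
      ∫ x, f x * coeff j ((C a + C b * X) * expKernel c x) := by
  simp only [coeff_linear_mul, coeff_momentSeries, mul_add]
  rcases j with _ | j
  · simp only [if_true, mul_zero, add_zero, ← integral_const_mul]
    congr 1; ext x; ring
  · simp only [Nat.succ_ne_zero, if_false, ← integral_const_mul]
    rw [← integral_add ((integrable_mul_coeff_expKernel hf hc c _).const_mul a)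
      ((integrable_mul_coeff_expKernel hf hc c _).const_mul b)]
    congr 1; ext x; ring

/-- Integration by parts, coefficient by coefficient; compact support removes the boundary terms. -/
theorem momentSeries_deriv {f : ℝ → ℂ} (hf : ContDiff ℝ 1 f) (hc : HasCompactSupport f) (c : ℝ) :
    momentSeries c (deriv f) = (C (Complex.I * c) + C Complex.I * X) * momentSeries c f := by
  ext j
  have hf' : Continuous (deriv f) := hf.continuous_deriv le_rfl
  rw [coeff_linear_mul_momentSeries hf.continuous hc, coeff_momentSeries, ← sub_eq_zero]
  have hcont : Continuous fun x =>
      coeff j ((C (Complex.I * c) + C Complex.I * X) * expKernel c x) := by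
    simp only [coeff_linear_mul]
    split_ifs
    · exact (continuous_const.mul (continuous_coeff_expKernel c _)).add continuous_const
    · exact (continuous_const.mul (continuous_coeff_expKernel c _)).add
        (continuous_const.mul (continuous_coeff_expKernel c _))
  have hi1 := integrable_mul_coeff_expKernel hf' hc.deriv c j
  have hi2 : Integrable fun x =>
      f x * coeff j ((C (Complex.I * c) + C Complex.I * X) * expKernel c x) :=
    (hf.continuous.mul hcont).integrable_of_hasCompactSupport hc.mul_right
  rw [← integral_sub hi1 hi2]
  refine integral_eq_zero_of_hasDerivAt_of_integrable
    (f := fun x => f x * coeff j (expKernel c x)) (fun x => ?_) (hi1.sub hi2)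
    (integrable_mul_coeff_expKernel hf.continuous hc c j)
  convert! (hf.differentiable one_ne_zero x).hasDerivAt.mul (hasDerivAt_coeff_expKernel c x j)
    using 1
  ring

theorem momentSeries_iteratedDeriv {f : ℝ → ℂ} {l : ℕ} (hf : ContDiff ℝ l f)
    (hc : HasCompactSupport f) (c : ℝ) :
    momentSeries c (iteratedDeriv l f) =
      (C (Complex.I * c) + C Complex.I * X) ^ l * momentSeries c f := by
  induction l generalizing f with
  | zero => simp
  | succ l ih =>
    have h1 : ContDiff ℝ 1 f := hf.of_le (by exact_mod_cast Nat.le_add_left 1 l)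
    rw [iteratedDeriv_succ', ih (f := deriv f) _ hc.deriv, momentSeries_deriv h1 hc, pow_succ,
      mul_assoc]
    exact ContDiff.deriv' (by exact_mod_cast hf)

/-- The Riemann–Lebesgue lemma for f times a monomial, with c divided by 2π to match the
normalization of `Real.fourierChar`. -/
theorem tendsto_coeff_momentSeries (f : ℝ → ℂ) (j : ℕ) :
    Tendsto (fun c => coeff j (momentSeries c f)) (cocompact ℝ) (𝓝 0) := by
  have h := (Real.tendsto_integral_exp_smul_cocompact
    fun x => f x * ((-(Complex.I * x)) ^ j / j.factorial)).comp
    (Homeomorph.mulRight₀ (2 * Real.pi)⁻¹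
      (by positivity)).isClosedEmbedding.tendsto_cocompact
  refine h.congr fun c => ?_
  rw [coeff_momentSeries]
  simp only [Function.comp_apply, Homeomorph.coe_mulRight₀]
  congr 1; ext x
  rw [coeff_expKernel, Circle.smul_def, Real.fourierChar_apply, smul_eq_mul, mul_left_comm]
  congr 3
  push_cast
  have : (Real.pi : ℂ) ≠ 0 := by exact_mod_cast Real.pi_ne_zero
  field_simp

/-- Writing M_j for the jth coefficient, `momentSeries_deriv` reads M_j(f') = ic M_j(f) + i
M_{j-1}(f). Solving for c M_j(f) and multiplying by c^m reduces order m + 1 to order m, for f' at j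
and for f at j - 1. -/
theorem tendsto_pow_mul_coeff_momentSeries {f : ℝ → ℂ} {m : ℕ} (hf : ContDiff ℝ m f)
    (hc : HasCompactSupport f) (j : ℕ) :
    Tendsto (fun c : ℝ => (c : ℂ) ^ m * coeff j (momentSeries c f)) (cocompact ℝ) (𝓝 0) := by
  induction m generalizing f j with
  | zero => simpa using tendsto_coeff_momentSeries f j
  | succ m ih =>
    have h1 : ContDiff ℝ 1 f := hf.of_le (by exact_mod_cast Nat.le_add_left 1 m)
    have hd := ih (f := deriv f) (ContDiff.deriv' (by exact_mod_cast hf)) hc.deriv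
    have hm : ContDiff ℝ m f := hf.of_le (by exact_mod_cast Nat.le_succ m)
    have key : ∀ c : ℝ, (c : ℂ) ^ (m + 1) * coeff j (momentSeries c f)
        = -Complex.I * ((c : ℂ) ^ m * coeff j (momentSeries c (deriv f)))
          - (c : ℂ) ^ m * (if j = 0 then 0 else coeff (j - 1) (momentSeries c f)) := fun c => by
      rw [momentSeries_deriv h1 hc, coeff_linear_mul]
      linear_combination ((c : ℂ) ^ (m + 1) * coeff j (momentSeries c f) +
        (c : ℂ) ^ m * (if j = 0 then 0 else coeff (j - 1) (momentSeries c f))) * Complex.I_sq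
    simp only [key]
    have h2 : Tendsto (fun c : ℝ => (c : ℂ) ^ m *
        (if j = 0 then 0 else coeff (j - 1) (momentSeries c f))) (cocompact ℝ) (𝓝 0) := by
      split_ifs
      · simp
      · exact ih hm hc _
    simpa using ((hd j).const_mul (-Complex.I)).sub h2

theorem momentSeries_comp_sub (f : ℝ → ℂ) (hf : Continuous f) (hc : HasCompactSupport f)
    (c k : ℝ) :
    momentSeries c (fun x => f (x - k)) = expKernel c k * momentSeries c f := by
  ext j
  rw [coeff_momentSeries, ← integral_add_right_eq_self _ k, coeff_mul]
  simp only [add_sub_cancel_right, expKernel_add, coeff_momentSeries, ← integral_const_mul]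
  rw [← integral_finsetSum _ fun p _ =>
    (integrable_mul_coeff_expKernel hf hc c p.2).const_mul (coeff p.1 (expKernel c k))]
  congr 1; ext x
  rw [mul_comm (expKernel c x), coeff_mul, Finset.mul_sum]
  exact Finset.sum_congr rfl fun p _ => by ring

theorem rescale_momentSeries_comp_mul (f : ℝ → ℂ) (c : ℝ) :
    rescale 2 (momentSeries (2 * c) fun x => f (2 * x)) = C 2⁻¹ * momentSeries c f := by
  ext j
  rw [coeff_rescale, coeff_C_mul, coeff_momentSeries, coeff_momentSeries, ← integral_const_mul]
  have h := Measure.integral_comp_mul_left (fun x => f x * coeff j (expKernel c x)) 2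
  rw [abs_of_pos (by norm_num), Complex.real_smul] at h
  push_cast at h
  rw [← h]
  congr 1; ext x
  have := congrArg (coeff j) (rescale_expKernel c x 2)
  rw [coeff_rescale] at this
  push_cast at this
  rw [← this]; ring

theorem iteratedDeriv_pi_apply {ι : Type*} [Fintype ι] {f : ℝ → ι → ℂ} {m : ℕ}
    (hf : ContDiff ℝ m f) {l : ℕ} (hl : l ≤ m) (x : ℝ) (i : ι) :
    iteratedDeriv l f x i = iteratedDeriv l (fun x => f x i) x := by
  have h := (ContinuousLinearMap.proj (R := ℝ) (φ := fun _ : ι => ℂ) i).iteratedFDeriv_comp_left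
    (hf.contDiffAt (x := x)) (i := l) (by exact_mod_cast hl)
  rw [iteratedDeriv_eq_iteratedFDeriv, iteratedDeriv_eq_iteratedFDeriv]
  exact (congrArg (fun T => T fun _ => 1) h).symm

theorem tendsto_floor_pow_div (x : ℝ) :
    Tendsto (fun n : ℕ => ((⌊2 ^ n * x⌋ : ℤ) : ℝ) / 2 ^ n) atTop (𝓝 x) := by
  have h0 : Tendsto (fun n : ℕ => (2 : ℝ)⁻¹ ^ n) atTop (𝓝 0) :=
    tendsto_pow_atTop_nhds_zero_of_lt_one (by norm_num) (by norm_num)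
  refine tendsto_of_tendsto_of_tendsto_of_le_of_le
    (by simpa using tendsto_const_nhds.sub h0) tendsto_const_nhds (fun n => ?_) (fun n => ?_)
  · have := Int.sub_one_lt_floor (2 ^ n * x)
    simp only
    rw [le_div_iff₀ (by positivity), sub_mul, inv_mul_cancel₀ (by positivity)]
    linarith
  · simp only
    rw [div_le_iff₀ (by positivity), mul_comm x]
    exact Int.floor_le _

theorem hasCompactSupport_finsetSum {ι : Type*} (s : Finset ι) {f : ι → ℝ → ℂ}
    (hf : ∀ i ∈ s, HasCompactSupport (f i)) : HasCompactSupport fun x => ∑ i ∈ s, f i x := by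
  classical
  induction s using Finset.induction_on with
  | empty => exact HasCompactSupport.zero
  | insert i s hi ih =>
    simp only [Finset.sum_insert hi]
    exact (hf i (by simp)).add (ih fun k hk => hf k (by simp [hk]))

theorem momentSeries_sum {ι : Type*} (s : Finset ι) (f : ι → ℝ → ℂ) {c : ℝ}
    (hf : ∀ i ∈ s, Continuous (f i)) (hc : ∀ i ∈ s, HasCompactSupport (f i)) :
    momentSeries c (fun x => ∑ i ∈ s, f i x) = ∑ i ∈ s, momentSeries c (f i) := by
  ext j
  simp only [map_sum, coeff_momentSeries, Finset.sum_mul]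
  exact integral_finsetSum _ fun i hi => integrable_mul_coeff_expKernel (hf i hi) (hc i hi) c j

theorem momentSeries_const_mul (z : ℂ) (f : ℝ → ℂ) (c : ℝ) :
    momentSeries c (fun x => z * f x) = C z * momentSeries c f := by
  ext j
  simp only [coeff_C_mul, coeff_momentSeries, mul_assoc, integral_const_mul]

/-! ### Fourier transform of the basis function: limits, refinability, normalization. -/

section Basis

variable {r m : ℕ} {a : ℤ →₀ Matrix (Fin r) (Fin r) ℂ} {φ : ℝ → Fin r → ℂ}

namespace IsBasisVectorFunction

theorem contDiff_apply (hφ : IsBasisVectorFunction a m φ) (i : Fin r) :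
    ContDiff ℝ m fun x => φ x i :=
  contDiff_pi.1 hφ.1 i

theorem hasCompactSupport_apply (hφ : IsBasisVectorFunction a m φ) (i : Fin r) :
    HasCompactSupport fun x => φ x i :=
  hφ.2.1.comp_left (g := fun v : Fin r → ℂ => v i) rfl

theorem continuous_apply (hφ : IsBasisVectorFunction a m φ) (i : Fin r) :
    Continuous fun x => φ x i :=
  (hφ.contDiff_apply i).continuous

theorem fourierTransform_apply (hφ : IsBasisVectorFunction a m φ) (ξ : ℝ) (i : Fin r) :
    fourierTransform φ ξ i = constantCoeff (momentSeries ξ fun x => φ x i) := by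
  rw [← coeff_zero_eq_constantCoeff_apply, coeff_momentSeries, fourierTransform, eval_integral]
  · congr 1; ext x
    rw [coeff_expKernel]
    simp [mul_comm]
  · intro i
    refine Continuous.integrable_of_hasCompactSupport ?_ ?_
    · simp only [Pi.smul_apply, smul_eq_mul]
      exact Continuous.mul (by fun_prop) (hφ.continuous_apply i)
    · exact (hφ.hasCompactSupport_apply i).mul_left

theorem continuous_fourierTransform_apply (hφ : IsBasisVectorFunction a m φ) (i : Fin r) :
    Continuous fun ξ => fourierTransform φ ξ i := by
  simp only [hφ.fourierTransform_apply, ← coeff_zero_eq_constantCoeff_apply, coeff_momentSeries,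
    coeff_expKernel, pow_zero, Nat.factorial_zero, Nat.cast_one, div_one, mul_one]
  refine continuous_of_dominated (bound := fun x => ‖φ x i‖) (fun ξ => ?_) (fun ξ => ?_) ?_ ?_
  · exact ((hφ.continuous_apply i).mul (by fun_prop)).aestronglyMeasurable
  · refine .of_forall fun x => ?_
    rw [norm_mul, Complex.norm_exp]
    simp
  · exact ((hφ.continuous_apply i).integrable_of_hasCompactSupport
      (hφ.hasCompactSupport_apply i)).norm
  · exact .of_forall fun x => by fun_prop

/-- The left side is a Riemann sum on the grid 2⁻ⁿℤ of φ_i^{(l)} against a kernel coefficient: the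
factor 2^{nl} is the lth diagonal entry of D⁻ⁿ, and each derivative contributes iξ = ic + iX. -/
theorem tendsto_coeff_iterateSeries (hφ : IsBasisVectorFunction a m φ) (hm : r - 1 ≤ m)
    (c : ℝ) (i l : Fin r) (j : ℕ) :
    Tendsto (fun n : ℕ => coeff j (iterateSeries a c n i l) * 2 ^ (n * (l : ℕ))) atTop
      (𝓝 (coeff j ((C (Complex.I * c) + C Complex.I * X) ^ (l : ℕ) *
        momentSeries c fun x => φ x i))) := by
  have hlm : (l : ℕ) ≤ m := by have := l.2; omega
  have hcd : ContDiff ℝ (l : ℕ) fun x => φ x i :=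
    (hφ.contDiff_apply i).of_le (by exact_mod_cast hlm)
  set f : ℝ → ℂ := fun x => φ x i with hf
  have hcs : HasCompactSupport f := hφ.hasCompactSupport_apply i
  have hcont : Continuous (iteratedDeriv (l : ℕ) f) := hcd.continuous_iteratedDeriv _ le_rfl
  have hcs' : HasCompactSupport (iteratedDeriv (l : ℕ) f) := by
    have := hcs.iteratedFDeriv (𝕜 := ℝ) (l : ℕ)
    refine this.mono fun x hx => ?_
    rw [Function.mem_support] at hx ⊢
    intro h
    exact hx (by rw [iteratedDeriv_eq_iteratedFDeriv, h]; rfl)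
  rw [← momentSeries_iteratedDeriv hcd hcs, coeff_momentSeries]
  obtain ⟨K₁, hK₁⟩ : ∃ K₁ : ℕ, ∀ x : ℝ, (K₁ : ℝ) ≤ |x| → iteratedDeriv (l : ℕ) f x = 0 := by
    obtain ⟨R, hR⟩ := hcs'.isBounded.subset_closedBall 0
    obtain ⟨K₁, hK₁⟩ := exists_nat_gt R
    refine ⟨K₁, fun x hx => image_eq_zero_of_notMem_tsupport fun hx' => ?_⟩
    have := hR hx'
    rw [mem_closedBall_zero_iff, Real.norm_eq_abs] at this
    linarith
  obtain ⟨K₂, hK₂⟩ : ∃ K₂ : ℕ, ∀ k : ℤ, (K₂ : ℤ) < |k| → a k = 0 := by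
    refine ⟨a.support.sup Int.natAbs, fun k hk => ?_⟩
    by_contra h
    have : k.natAbs ≤ a.support.sup Int.natAbs :=
      Finset.le_sup (f := Int.natAbs) (Finsupp.mem_support_iff.2 h)
    rw [Int.abs_eq_natAbs] at hk
    omega
  -- One radius outside which both φ_i^{(l)} and the rescaled mask iterates vanish; the 1 makes the
  -- comparison with 2ⁿK₂ strict.
  set K : ℕ := K₁ + K₂ + 1 with hK
  have hA : ∀ n (k : ℤ), (2 ^ n * K : ℤ) ≤ |k| → maskIterate a n k = 0 := fun n k hk =>
    maskIterate_eq_zero hK₂ (by positivity) n (lt_of_lt_of_le (by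
      rw [hK]; push_cast; nlinarith [pow_pos (show (0 : ℤ) < 2 by norm_num) n]) hk)
  have hD : ∀ x : ℝ, (K : ℝ) ≤ |x| → iteratedDeriv (l : ℕ) f x = 0 := fun x hx =>
    hK₁ x (le_trans (by rw [hK]; push_cast; linarith [(Nat.cast_nonneg K₂ : (0 : ℝ) ≤ K₂)]) hx)
  obtain ⟨B, hB⟩ := (isCompact_Icc (a := -(K : ℝ)) (b := K)).exists_bound_of_continuousOn
    (continuous_coeff_expKernel c j).continuousOn
  have key := tendsto_dyadic_riemannSum
    (G := fun x => iteratedDeriv (l : ℕ) f x * coeff j (expKernel c x))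
    (hcont.mul (continuous_coeff_expKernel c j)) (K := K) (fun x hx => by simp [hD x hx])
    (F := fun n k => maskIterate a n k i l * 2 ^ (n * (l : ℕ)) *
      coeff j (expKernel c ((k : ℝ) / 2 ^ n))) ?_
  · refine key.congr fun n => ?_
    rw [iterateSeries, Matrix.smul_apply, PowerSeries.smul_eq_C_mul, coeff_C_mul,
      coeff_symbolSeries, mul_assoc]
    congr 1
    rw [Finsupp.sum_of_support_subset (s := Finset.Ico (-(2 ^ n * K : ℤ)) (2 ^ n * K)),
      Finset.sum_mul]
    · refine Finset.sum_congr rfl fun k _ => ?_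
      rw [show (2 : ℝ)⁻¹ ^ n * k = (k : ℝ) / 2 ^ n by rw [inv_pow]; ring]
      ring
    · intro k hk
      rw [Finsupp.mem_support_iff] at hk
      by_contra h
      refine hk (hA n k ?_)
      rw [Finset.mem_Ico] at h
      rcases abs_cases k with h' | h' <;> omega
    · simp
  · intro ε hε
    -- B bounds the kernel coefficient on [-K, K]; adding 1 keeps the quotient defined and the final
    -- inequality strict.
    obtain ⟨N, hN⟩ := hφ.2.2 (ε / (|B| + 1)) (by positivity)
    refine ⟨N, fun n hn k => ?_⟩
    rw [← sub_mul, norm_mul]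
    by_cases hk : (2 ^ n * K : ℤ) ≤ |k|
    · have hk' : (K : ℝ) ≤ |(k : ℝ) / 2 ^ n| := by
        rw [abs_div, abs_of_pos (by positivity : (0 : ℝ) < 2 ^ n), le_div_iff₀ (by positivity)]
        have : ((2 ^ n * K : ℤ) : ℝ) ≤ |k| := by exact_mod_cast hk
        push_cast at this
        linarith
      rw [hA n k hk, hD _ hk']
      simpa using hε
    · have hk' : (k : ℝ) / 2 ^ n ∈ Set.Icc (-(K : ℝ)) K := by
        rw [Set.mem_Icc, ← abs_le, abs_div,
          abs_of_pos (by positivity : (0 : ℝ) < 2 ^ n), div_le_iff₀ (by positivity)]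
        have : ((|k| : ℤ) : ℝ) ≤ (2 ^ n * K : ℤ) := by exact_mod_cast (not_le.1 hk).le
        push_cast at this
        linarith
      have h1 := hN n hn k i l
      rw [refinement_dirac_apply, iteratedDeriv_pi_apply hφ.1 hlm] at h1
      calc _ ≤ ε / (|B| + 1) * |B| :=
            mul_le_mul h1.le ((hB _ hk').trans (le_abs_self B)) (norm_nonneg _) (by positivity)
        _ < ε / (|B| + 1) * (|B| + 1) := by
            have : 0 < ε / (|B| + 1) := by positivity
            nlinarith
        _ = ε := by field_simp

/-- In the first column D⁻ⁿ acts trivially, so the unscaled iterates themselves sample φ. -/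
theorem tendsto_maskIterate_apply (hφ : IsBasisVectorFunction a m φ) (hr : 0 < r) {k : ℕ → ℤ}
    {x : ℝ} (hk : Tendsto (fun n => (k n : ℝ) / 2 ^ n) atTop (𝓝 x)) (i : Fin r) :
    Tendsto (fun n => maskIterate a n (k n) i ⟨0, hr⟩) atTop (𝓝 (φ x i)) := by
  have h1 := ((hφ.continuous_apply i).tendsto x).comp hk
  have h2 : Tendsto (fun n => maskIterate a n (k n) i ⟨0, hr⟩ - φ ((k n : ℝ) / 2 ^ n) i) atTop
      (𝓝 0) := by
    rw [Metric.tendsto_atTop]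
    intro ε hε
    obtain ⟨N, hN⟩ := hφ.2.2 ε hε
    refine ⟨N, fun n hn => ?_⟩
    have := hN n hn (k n) i ⟨0, hr⟩
    rw [refinement_dirac_apply] at this
    simpa using this
  simpa using h2.add h1

/-- Limit of `maskIterate_succ_apply` along k = ⌊2^{n+1}x⌋: then k/2^{n+1} → x while (k - 2ⁿl)/2ⁿ →
2x - l. -/
theorem refinable (hφ : IsBasisVectorFunction a m φ) (hr : 0 < r) (x : ℝ) :
    φ x = (2 : ℂ) • a.sum fun k A => Matrix.mulVec A (φ (2 * x - k)) := by
  ext i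
  set k : ℕ → ℤ := fun n => ⌊2 ^ n * x⌋
  have h1 := (tendsto_add_atTop_iff_nat 1).2
    (hφ.tendsto_maskIterate_apply hr (tendsto_floor_pow_div x) i)
  refine tendsto_nhds_unique h1 ?_
  simp only [maskIterate_succ_apply, Pi.smul_apply, Matrix.smul_apply, Finsupp.sum,
    Finset.sum_apply, Matrix.sum_apply, Matrix.mul_apply, Matrix.mulVec, dotProduct]
  refine (tendsto_finsetSum _ fun l _ => tendsto_finsetSum _ fun p _ =>
    Tendsto.const_mul _ (hφ.tendsto_maskIterate_apply hr ?_ p)).const_smul _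
  have h2 := (((tendsto_add_atTop_iff_nat 1).2 (tendsto_floor_pow_div x)).const_mul 2).sub_const
    (l : ℝ)
  refine h2.congr fun n => ?_
  push_cast
  rw [pow_succ]
  field_simp

/-- The relation φ̂(2ξ) = â(ξ)φ̂(ξ), with all Taylor coefficients, at an arbitrary base point. -/
theorem rescale_momentSeries (hφ : IsBasisVectorFunction a m φ) (hr : 0 < r) (c : ℝ)
    (i : Fin r) :
    rescale 2 (momentSeries (2 * c) fun x => φ x i) =
      ∑ p, symbolSeries c 1 a i p * momentSeries c fun x => φ x p := by
  obtain ⟨G, hG⟩ : ∃ G : ℝ → ℂ, G = fun y =>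
    ∑ p, ∑ k ∈ a.support, (2 * a k i p) * φ (y - (k : ℝ)) p := ⟨_, rfl⟩
  have h1 : (fun x => φ x i) = fun x => G (2 * x) := by
    ext x
    rw [hφ.refinable hr x, hG]
    simp only [Finsupp.sum, Matrix.mulVec, dotProduct, Pi.smul_apply, Finset.sum_apply,
      smul_eq_mul, Finset.mul_sum, mul_assoc]
    exact Finset.sum_comm
  have hcont : ∀ (k : ℤ) (p : Fin r), Continuous fun y => φ (y - (k : ℝ)) p := fun k p =>
    (hφ.continuous_apply p).comp (continuous_sub_right (k : ℝ))
  have hcs : ∀ (k : ℤ) (p : Fin r), HasCompactSupport fun y => φ (y - (k : ℝ)) p := fun k p =>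
    (hφ.hasCompactSupport_apply p).comp_homeomorph (Homeomorph.subRight (k : ℝ))
  have h2 : momentSeries c G = ∑ p, ∑ k ∈ a.support,
      C (2 * a k i p) * (expKernel c k * momentSeries c fun x => φ x p) := by
    rw [hG, momentSeries_sum _ _ fun p _ => continuous_finsetSum _ fun k _ =>
      (hcont k p).const_mul _]
    · refine Finset.sum_congr rfl fun p _ => ?_
      rw [momentSeries_sum _ _ fun k _ => (hcont k p).const_mul _]
      · refine Finset.sum_congr rfl fun k _ => ?_
        rw [momentSeries_const_mul,
          momentSeries_comp_sub _ (hφ.continuous_apply p) (hφ.hasCompactSupport_apply p)]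
      · exact fun k _ => (hcs k p).mul_left
    · exact fun p _ => hasCompactSupport_finsetSum _ fun k _ => (hcs k p).mul_left
  rw [h1, rescale_momentSeries_comp_mul, h2, Finset.mul_sum]
  refine Finset.sum_congr rfl fun p _ => ?_
  rw [symbolSeries_apply, Finsupp.sum, Finset.sum_mul, Finset.mul_sum]
  refine Finset.sum_congr rfl fun k _ => ?_
  rw [one_mul, ← mul_assoc, ← map_mul, inv_mul_cancel_left₀ two_ne_zero, mul_assoc]

theorem fourierTransform_two_mul (hφ : IsBasisVectorFunction a m φ) (hr : 0 < r) (ξ : ℝ) :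
    fourierTransform φ (2 * ξ) = Matrix.mulVec (symbol a ξ) (fourierTransform φ ξ) := by
  ext i
  have h := congrArg constantCoeff (hφ.rescale_momentSeries hr ξ i)
  rw [map_sum, ← coeff_zero_eq_constantCoeff_apply, coeff_rescale, pow_zero, one_mul,
    coeff_zero_eq_constantCoeff_apply] at h
  rw [hφ.fourierTransform_apply, h, Matrix.mulVec, dotProduct]
  refine Finset.sum_congr rfl fun p _ => ?_
  rw [map_mul, constantCoeff_symbolSeries, one_mul, hφ.fourierTransform_apply]

theorem fourierTransform_eq_symbolProduct (hφ : IsBasisVectorFunction a m φ) (hr : 0 < r) (ξ : ℝ)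
    (n : ℕ) :
    fourierTransform φ ξ =
      Matrix.mulVec (symbolProduct a ξ n) (fourierTransform φ (ξ / 2 ^ n)) := by
  induction n with
  | zero => simp [symbolProduct]
  | succ n ih =>
    rw [ih, symbolProduct, symbolProduct, List.range_succ, List.map_append, List.prod_append,
      ← Matrix.mulVec_mulVec]
    congr 1
    have := hφ.fourierTransform_two_mul hr (ξ / 2 ^ (n + 1))
    rw [show 2 * (ξ / 2 ^ (n + 1)) = ξ / 2 ^ n by rw [pow_succ]; field_simp] at this
    simpa using this

/-- The constant coefficient of `tendsto_coeff_iterateSeries`. A later column converges even after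
multiplication by 2^{nl} with l > 0, so it tends to 0. -/
theorem tendsto_symbolProduct_apply (hφ : IsBasisVectorFunction a m φ) (hr : 0 < r)
    (hm : r - 1 ≤ m) (ξ : ℝ) (i l : Fin r) :
    Tendsto (fun n => symbolProduct a ξ n i l) atTop
      (𝓝 (if l = ⟨0, hr⟩ then fourierTransform φ ξ i else 0)) := by
  have h := hφ.tendsto_coeff_iterateSeries hm ξ i l 0
  simp only [coeff_zero_eq_constantCoeff_apply, constantCoeff_iterateSeries] at h
  split_ifs with hl
  · subst hl
    simpa [hφ.fourierTransform_apply] using h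
  · have hl' : (l : ℕ) ≠ 0 := fun h => hl (Fin.ext h)
    have h0 : Tendsto (fun n : ℕ => ((2 : ℂ)⁻¹ ^ (l : ℕ)) ^ n) atTop (𝓝 0) :=
      tendsto_pow_atTop_nhds_zero_of_norm_lt_one (by
        rw [norm_pow]; exact pow_lt_one₀ (norm_nonneg _) (by norm_num) hl')
    have := h.mul h0
    rw [mul_zero] at this
    refine this.congr fun n => ?_
    rw [mul_assoc, ← pow_mul, mul_comm n, ← mul_pow, mul_inv_cancel₀ two_ne_zero, one_pow, mul_one]

theorem tendsto_symbolProduct_mulVec (hφ : IsBasisVectorFunction a m φ) (hr : 0 < r)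
    (hm : r - 1 ≤ m) (ξ : ℝ) :
    Tendsto (fun n : ℕ => Matrix.mulVec (symbolProduct a ξ n) (Pi.single ⟨0, hr⟩ 1))
      atTop (𝓝 (fourierTransform φ ξ)) := by
  refine tendsto_pi_nhds.2 fun i => ?_
  simpa using hφ.tendsto_symbolProduct_apply hr hm ξ i ⟨0, hr⟩

/-- Letting n → ∞ in φ̂(ξ) = Π_n(ξ)φ̂(ξ/2ⁿ) gives φ̂(ξ) = φ̂(ξ)·e₁ᵀφ̂(0); a nonzero entry cancels.
-/
theorem fourierTransform_zero_apply (hφ : IsBasisVectorFunction a m φ) (hr : 0 < r)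
    (hm : r - 1 ≤ m) {ξ : ℝ} (hξ : fourierTransform φ ξ ≠ 0) :
    fourierTransform φ 0 ⟨0, hr⟩ = 1 := by
  obtain ⟨i, hi⟩ := Function.ne_iff.1 hξ
  have hdiv : Tendsto (fun n : ℕ => ξ / 2 ^ n) atTop (𝓝 0) :=
    tendsto_const_nhds.div_atTop (tendsto_pow_atTop_atTop_of_one_lt one_lt_two)
  have h : Tendsto (fun n => ∑ l, symbolProduct a ξ n i l * fourierTransform φ (ξ / 2 ^ n) l) atTop
      (𝓝 (∑ l, (if l = ⟨0, hr⟩ then fourierTransform φ ξ i else 0) * fourierTransform φ 0 l)) :=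
    tendsto_finsetSum _ fun l _ => (hφ.tendsto_symbolProduct_apply hr hm ξ i l).mul
      (((hφ.continuous_fourierTransform_apply l).tendsto 0).comp hdiv)
  have h2 : (fun n => ∑ l, symbolProduct a ξ n i l * fourierTransform φ (ξ / 2 ^ n) l) =
      fun _ => fourierTransform φ ξ i := by
    ext n
    exact (congrFun (hφ.fourierTransform_eq_symbolProduct hr ξ n) i).symm
  rw [h2] at h
  have h3 := tendsto_nhds_unique h tendsto_const_nhds
  simp only [ite_mul, zero_mul, Finset.sum_ite_eq', Finset.mem_univ, if_true] at h3
  exact mul_left_cancel₀ hi (by rw [mul_one]; exact h3)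

end IsBasisVectorFunction

end Basis

/-! ### Linear algebra: simple eigenvalues and order-by-order solution. -/

/-- If the powers of `A` converge to the rank-one matrix `v e_kᵀ` with `v k = 1`, then `1` is an
algebraically simple eigenvalue of `A`. -/
theorem rootMultiplicity_charpoly_one_of_tendsto_pow {r : ℕ} {A : Matrix (Fin r) (Fin r) ℂ}
    {v : Fin r → ℂ} {k : Fin r} (hv : v k = 1)
    (hA : Tendsto (fun n : ℕ => A ^ n) atTop (𝓝 (Matrix.vecMulVec v (Pi.single k 1)))) :
    A.charpoly.rootMultiplicity 1 = 1 := by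
  set P := Matrix.vecMulVec v (Pi.single k (1 : ℂ)) with hP
  have hAP : A * P = P := by
    refine tendsto_nhds_unique ((hA.const_mul A).congr fun n => (pow_succ' A n).symm)
      ((tendsto_add_atTop_iff_nat 1).2 hA)
  have hPA : P * A = P := by
    refine tendsto_nhds_unique ((hA.mul_const A).congr fun n => (pow_succ A n).symm)
      ((tendsto_add_atTop_iff_nat 1).2 hA)
  have hPP : P * P = P := by
    rw [hP, Matrix.vecMulVec_mul_vecMulVec]
    simp [hv]
  -- Since PA = P = P², one has (X - P)(X - (A - P)) = X(X - A). Determinants then reduce the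
  -- multiplicity of 1 for A to those for P and A - P.
  have hprod : (Matrix.charmatrix P) * (Matrix.charmatrix (A - P)) =
      (Polynomial.X : Polynomial ℂ) • Matrix.charmatrix A := by
    have h0 : (Polynomial.C.mapMatrix P) * (Polynomial.C.mapMatrix A) =
        (Polynomial.C.mapMatrix P) * (Polynomial.C.mapMatrix P) := by
      rw [← map_mul, ← map_mul, hPA, hPP]
    simp only [Matrix.charmatrix, sub_mul, mul_sub, map_sub]
    simp only [Matrix.scalar_apply, ← Matrix.smul_one_eq_diagonal, smul_mul_assoc, one_mul,
      mul_smul_comm, mul_one, smul_sub]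
    rw [h0]
    abel
  have hdet := congrArg Matrix.det hprod
  rw [Matrix.det_mul, Matrix.det_smul, Fintype.card_fin] at hdet
  change P.charpoly * (A - P).charpoly = Polynomial.X ^ r * A.charpoly at hdet
  -- An eigenvector of A - P for 1 would be fixed by (A - P)ⁿ = Aⁿ - P, which tends to 0.
  have hN : (A - P).charpoly.rootMultiplicity 1 = 0 := by
    rw [Polynomial.rootMultiplicity_eq_zero_iff]
    intro hroot
    exfalso
    rw [Polynomial.IsRoot.def, Matrix.eval_charpoly, ← Matrix.exists_mulVec_eq_zero_iff] at hroot
    obtain ⟨x, hx0, hx⟩ := hroot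
    have hx' : Matrix.mulVec (A - P) x = x := by
      rw [Matrix.sub_mulVec] at hx
      simpa [eq_comm, sub_eq_zero] using hx
    have hpow : ∀ n : ℕ, 1 ≤ n → (A - P) ^ n = A ^ n - P := fun n hn => by
      induction n, hn using Nat.le_induction with
      | base => simp
      | succ n hn ih =>
        have hPn : P * A ^ n = P := by
          clear ih hn
          induction n with
          | zero => simp
          | succ n ih => rw [pow_succ, ← mul_assoc, ih, hPA]
        rw [pow_succ', ih, sub_mul, mul_sub, mul_sub, hAP, hPP, hPn, ← pow_succ']
        abel
    have hfix : ∀ n : ℕ, Matrix.mulVec ((A - P) ^ n) x = x := fun n => by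
      induction n with
      | zero => simp
      | succ n ih => rw [pow_succ, ← Matrix.mulVec_mulVec, hx', ih]
    have hlim : Tendsto (fun n : ℕ => (A - P) ^ n) atTop (𝓝 0) := by
      have := hA.sub_const P
      rw [sub_self] at this
      refine this.congr' ?_
      filter_upwards [eventually_ge_atTop 1] with n hn using (hpow n hn).symm
    have := ((continuous_id.matrix_mulVec continuous_const (B := fun _ => x)).tendsto
      (0 : Matrix (Fin r) (Fin r) ℂ)).comp hlim
    simp only [Function.comp_def, id_eq, hfix, Matrix.zero_mulVec] at this
    exact hx0 (tendsto_nhds_unique tendsto_const_nhds this)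
  have hPc : P.charpoly.rootMultiplicity 1 = 1 := by
    have hr : 0 < r := k.pos
    have h1 : P.charpoly = Polynomial.X ^ (r - 1) * (Polynomial.X - Polynomial.C 1) := by
      rw [hP, Matrix.charpoly_vecMulVec]
      obtain ⟨s, rfl⟩ := Nat.exists_eq_succ_of_ne_zero hr.ne'
      simp [hv, pow_succ, mul_sub]
    rw [h1, Polynomial.rootMultiplicity_mul (mul_ne_zero (pow_ne_zero _ Polynomial.X_ne_zero)
      (Polynomial.X_sub_C_ne_zero _)), Polynomial.rootMultiplicity_X_sub_C_self,
      Polynomial.rootMultiplicity_eq_zero (by simp)]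
  have hA0 := A.charpoly_monic.ne_zero
  have := congrArg (Polynomial.rootMultiplicity 1) hdet
  rwa [Polynomial.rootMultiplicity_mul (mul_ne_zero P.charpoly_monic.ne_zero
      (A - P).charpoly_monic.ne_zero), Polynomial.rootMultiplicity_mul
      (mul_ne_zero (pow_ne_zero _ Polynomial.X_ne_zero) hA0), hN, hPc,
    Polynomial.rootMultiplicity_eq_zero (p := Polynomial.X ^ r) (by simp), zero_add, add_zero,
    eq_comm] at this

/-- Order-by-order solution of `t(2X) A(X) = t(X) + O(X^{M+1})` with prescribed constant term. -/
theorem exists_matching_jet {r M : ℕ} (A : Matrix (Fin r) (Fin r) ℂ⟦X⟧) (y : Fin r → ℂ)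
    (hy : ∀ l, ∑ i, y i * coeff 0 (A i l) = y l)
    (hinv : ∀ j : ℕ, 1 ≤ j → j ≤ M → ∀ b : Fin r → ℂ, ∃ x : Fin r → ℂ,
      ∀ l, x l - 2 ^ j * ∑ i, x i * coeff 0 (A i l) = b l) :
    ∃ t : ℕ → Fin r → ℂ, t 0 = y ∧ ∀ j ≤ M, ∀ l,
      ∑ i, ∑ p ∈ Finset.HasAntidiagonal.antidiagonal j, 2 ^ p.1 * t p.1 i * coeff p.2 (A i l)
        = t j l := by
  induction M with
  | zero =>
    refine ⟨fun _ => y, rfl, fun j hj l => ?_⟩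
    obtain rfl : j = 0 := by omega
    simpa using hy l
  | succ M ih =>
    obtain ⟨t, ht0, ht⟩ := ih fun j h1 h2 => hinv j h1 (by omega)
    -- At order M + 1 the unknown x enters only through x and 2^{M+1}x times the constant
    -- coefficient of A; all other terms are known and form the right-hand side.
    obtain ⟨x, hx⟩ := hinv (M + 1) (by omega) le_rfl fun l =>
      ∑ i, ∑ p ∈ Finset.HasAntidiagonal.antidiagonal M,
        2 ^ p.1 * t p.1 i * coeff (p.2 + 1) (A i l)
    refine ⟨Function.update t (M + 1) x, by rw [Function.update_of_ne (by omega), ht0],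
      fun j hj l => ?_⟩
    rcases Nat.lt_or_ge j (M + 1) with h | h
    · rw [Function.update_of_ne h.ne, ← ht j (by omega) l]
      refine Finset.sum_congr rfl fun i _ => Finset.sum_congr rfl fun p hp => ?_
      have := Finset.HasAntidiagonal.mem_antidiagonal.1 hp
      rw [Function.update_of_ne (by omega)]
    · obtain rfl : j = M + 1 := by omega
      rw [Function.update_self]
      simp only [Finset.Nat.sum_antidiagonal_succ', Function.update_self, Finset.sum_add_distrib]
      have h1 : ∀ i, ∑ p ∈ Finset.HasAntidiagonal.antidiagonal M,
          2 ^ p.1 * Function.update t (M + 1) x p.1 i * coeff (p.2 + 1) (A i l) =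
          ∑ p ∈ Finset.HasAntidiagonal.antidiagonal M,
          2 ^ p.1 * t p.1 i * coeff (p.2 + 1) (A i l) := fun i =>
        Finset.sum_congr rfl fun p hp => by
          have := Finset.HasAntidiagonal.mem_antidiagonal.1 hp
          rw [Function.update_of_ne (by omega)]
      simp only [h1, ← hx l]
      simp only [mul_assoc, ← Finset.mul_sum]
      ring

/-! ### Decay along 2πℤ and the spectrum of â(0). -/

section Main

variable {r m : ℕ} {a : ℤ →₀ Matrix (Fin r) (Fin r) ℂ} {φ : ℝ → Fin r → ℂ}

theorem exists_dotProduct_ne_zero {ι : Type*} {w : ι → Fin r → ℂ}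
    (hw : Submodule.span ℂ (Set.range w) = ⊤) {y : Fin r → ℂ} (hy : y ≠ 0) :
    ∃ k, dotProduct y (w k) ≠ 0 := by
  by_contra! h
  refine hy (dotProduct_eq_zero y fun z => ?_)
  have hz : z ∈ Submodule.span ℂ (Set.range w) := hw ▸ Submodule.mem_top
  induction hz using Submodule.span_induction with
  | mem z hz => obtain ⟨k, rfl⟩ := hz; exact h k
  | zero => simp
  | add x y _ _ hx hy => rw [dotProduct_add, hx, hy, add_zero]
  | smul c x _ hx => rw [dotProduct_smul, hx, smul_zero]

theorem tendsto_cocompact_two_pi {k : ℤ} (hk : k ≠ 0) :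
    Tendsto (fun n : ℕ => 2 * Real.pi * ((2 ^ n * k : ℤ) : ℝ)) atTop (cocompact ℝ) := by
  refine tendsto_cocompact_of_tendsto_dist_comp_atTop 0 ?_
  have hpos : 0 < 2 * Real.pi * |(k : ℝ)| := by
    have := abs_pos.2 (Int.cast_ne_zero.2 hk : (k : ℝ) ≠ 0)
    positivity
  refine ((tendsto_pow_atTop_atTop_of_one_lt (one_lt_two (α := ℝ))).const_mul_atTop hpos).congr
    fun n => ?_
  rw [dist_zero_right, Real.norm_eq_abs]
  push_cast
  rw [abs_mul, abs_mul, abs_mul, abs_of_pos Real.pi_pos]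
  simp
  ring

namespace IsBasisVectorFunction

theorem tendsto_symbol_zero_pow (hφ : IsBasisVectorFunction a m φ) (hr : 0 < r)
    (hm : r - 1 ≤ m) :
    Tendsto (fun n : ℕ => symbol a 0 ^ n) atTop
      (𝓝 (Matrix.vecMulVec (fourierTransform φ 0) (Pi.single ⟨0, hr⟩ 1))) := by
  refine tendsto_pi_nhds.2 fun i => tendsto_pi_nhds.2 fun l => ?_
  have := hφ.tendsto_symbolProduct_apply hr hm 0 i l
  simp only [symbolProduct_zero_right] at this
  convert! this using 2
  simp [Matrix.vecMulVec_apply, Pi.single_apply]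

/-- The limit P = φ̂(0)e₁ᵀ of the powers of â(0) satisfies Pâ(0) = P; its first row is e₁ᵀ, so e₁ᵀ
is a left fixed vector. -/
theorem symbol_zero_row (hφ : IsBasisVectorFunction a m φ) (hr : 0 < r)
    (hm : r - 1 ≤ m) (h0 : fourierTransform φ 0 ⟨0, hr⟩ = 1) (l : Fin r) :
    symbol a 0 ⟨0, hr⟩ l = Pi.single (M := fun _ => ℂ) ⟨0, hr⟩ 1 l := by
  have hA := hφ.tendsto_symbol_zero_pow hr hm
  have h := tendsto_nhds_unique ((hA.mul_const (symbol a 0)).congr fun n => (pow_succ _ n).symm)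
    ((tendsto_add_atTop_iff_nat 1).2 hA)
  have := congrFun (congrFun h ⟨0, hr⟩) l
  simpa [Matrix.mul_apply, Matrix.vecMulVec_apply, h0, Pi.single_apply] using this

theorem fourierTransform_two_pi_mul_two_pow (hφ : IsBasisVectorFunction a m φ) (hr : 0 < r)
    (k : ℤ) (n : ℕ) :
    fourierTransform φ (2 * Real.pi * (2 ^ n * k : ℤ)) =
      Matrix.mulVec (symbol a 0 ^ n) (fourierTransform φ (2 * Real.pi * k)) := by
  induction n with
  | zero => simp
  | succ n ih =>
    have hper : symbol a (2 * Real.pi * (2 ^ n * k : ℤ)) = symbol a 0 := by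
      ext i l
      have := congrFun (congrFun (symbolSeries_add_two_pi 0 (2 ^ n * k) a) i) l
      have := congrArg constantCoeff this
      simpa [constantCoeff_symbolSeries] using this
    rw [pow_succ' (symbol a 0), ← Matrix.mulVec_mulVec, ← ih, ← hper, ← hφ.fourierTransform_two_mul hr]
    congr 1
    push_cast; ring

theorem tendsto_two_pow_mul_coeff_momentSeries (hφ : IsBasisVectorFunction a m φ) {k : ℤ}
    (hk : k ≠ 0) (i : Fin r) (j : ℕ) :
    Tendsto (fun n : ℕ => ((2 : ℂ) ^ n) ^ m *
        coeff j (momentSeries (2 * Real.pi * (2 ^ n * k : ℤ)) fun x => φ x i))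
      atTop (𝓝 0) := by
  have h := ((tendsto_pow_mul_coeff_momentSeries (hφ.contDiff_apply i)
    (hφ.hasCompactSupport_apply i) j).comp (tendsto_cocompact_two_pi hk)).const_mul
      (((2 * Real.pi * k : ℝ) : ℂ) ^ m)⁻¹
  rw [mul_zero] at h
  refine h.congr fun n => ?_
  have hz : ((2 * Real.pi * k : ℝ) : ℂ) ≠ 0 := by
    rw [Complex.ofReal_ne_zero]
    have := Real.pi_ne_zero
    have : (k : ℝ) ≠ 0 := Int.cast_ne_zero.2 hk
    positivity
  have h2 : ((2 * Real.pi * (2 ^ n * k : ℤ) : ℝ) : ℂ) = ((2 * Real.pi * k : ℝ) : ℂ) * 2 ^ n := by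
    push_cast; ring
  simp only [Function.comp_apply]
  rw [h2, mul_pow, ← mul_assoc, inv_mul_cancel_left₀ (pow_ne_zero _ hz)]

/-- Every eigenvalue of `â(0)` other than `1` is below `2^{-m}` in modulus. -/
theorem norm_eigenvalue_lt (hφ : IsBasisVectorFunction a m φ) (hr : 0 < r)
    (hspan0 : Submodule.span ℂ
      (Set.range fun k : ℤ => fourierTransform φ (2 * Real.pi * k)) = ⊤)
    {μ : ℂ} (hμ1 : μ ≠ 1) {y : Fin r → ℂ} (hy0 : y ≠ 0)
    (hy : Matrix.vecMul y (symbol a 0) = μ • y) : ‖μ‖ < ((2 : ℝ) ^ m)⁻¹ := by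
  obtain ⟨k, hk⟩ := exists_dotProduct_ne_zero hspan0 hy0
  have hpow : ∀ n : ℕ, Matrix.vecMul y (symbol a 0 ^ n) = μ ^ n • y := fun n => by
    induction n with
    | zero => simp
    | succ n ih => rw [pow_succ, ← Matrix.vecMul_vecMul, ih, Matrix.smul_vecMul, hy, smul_smul,
        pow_succ]
  -- The vector φ̂(0) is fixed by â(0), so a left eigenvector for μ ≠ 1 annihilates it.
  have hk0 : k ≠ 0 := by
    rintro rfl
    apply hk
    have h1 := hφ.fourierTransform_two_mul hr 0
    rw [mul_zero] at h1
    have h2 : dotProduct y (fourierTransform φ 0) = μ * dotProduct y (fourierTransform φ 0) := by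
      conv_lhs => rw [h1, Matrix.dotProduct_mulVec, hy, smul_dotProduct, smul_eq_mul]
    have h3 : (1 - μ) * dotProduct y (fourierTransform φ 0) = 0 := by linear_combination h2
    simpa [sub_eq_zero, hμ1.symm] using h3
  -- Up to the nonzero factor y·φ̂(2πk), this is 2^{nm} y·φ̂(2ⁿ2πk), which tends to 0; powers
  -- tending to 0 give a strict bound.
  have hlim : Tendsto (fun n : ℕ => (2 ^ m * μ) ^ n) atTop (𝓝 0) := by
    have h := (tendsto_finsetSum Finset.univ fun i _ =>
      (hφ.tendsto_two_pow_mul_coeff_momentSeries hk0 i 0).const_mul (y i)).mul_const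
        (dotProduct y (fourierTransform φ (2 * Real.pi * k)))⁻¹
    simp only [mul_zero, Finset.sum_const_zero, zero_mul] at h
    refine h.congr fun n => ?_
    have h1 : dotProduct y (fourierTransform φ (2 * Real.pi * (2 ^ n * k : ℤ))) =
        μ ^ n * dotProduct y (fourierTransform φ (2 * Real.pi * k)) := by
      rw [hφ.fourierTransform_two_pi_mul_two_pow hr, Matrix.dotProduct_mulVec, hpow,
        smul_dotProduct, smul_eq_mul]
    rw [mul_inv_eq_iff_eq_mul₀ hk, mul_pow, mul_assoc ((2 ^ m) ^ n), ← h1, dotProduct, Finset.mul_sum]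
    refine Finset.sum_congr rfl fun i _ => ?_
    rw [hφ.fourierTransform_apply, coeff_zero_eq_constantCoeff_apply, ← pow_mul, ← pow_mul,
      mul_comm n m]
    ring
  have := tendsto_pow_atTop_nhds_zero_iff_norm_lt_one.1 hlim
  rw [norm_mul, norm_pow, Complex.norm_ofNat] at this
  rwa [← one_div, lt_div_iff₀' (by positivity)]

end IsBasisVectorFunction

end Main

/-! ### Matching jets: existence, pairing with φ̂, sum rule at π, Hermite structure. -/

theorem X_pow_dvd_rescale {M : ℕ} {p : ℂ⟦X⟧} (h : X ^ M ∣ p) (t : ℂ) : X ^ M ∣ rescale t p := by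
  rw [X_pow_dvd_iff] at h ⊢
  intro j hj
  rw [coeff_rescale, h j hj, mul_zero]

theorem coeff_eq_of_X_pow_dvd_sub {M : ℕ} {p q : ℂ⟦X⟧} (h : X ^ M ∣ p - q) {j : ℕ} (hj : j < M) :
    coeff j p = coeff j q := by
  have := X_pow_dvd_iff.1 h j hj
  rwa [map_sub, sub_eq_zero] at this

section Main

variable {r m : ℕ} {a : ℤ →₀ Matrix (Fin r) (Fin r) ℂ} {φ : ℝ → Fin r → ℂ}

/-- The row of Taylor series `u` satisfies `u(2X) â(X) = u(X) + O(X^M)`. -/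
def IsMatchingJet (a : ℤ →₀ Matrix (Fin r) (Fin r) ℂ) (M : ℕ) (u : Fin r → ℂ⟦X⟧) : Prop :=
  ∀ l, X ^ M ∣ ∑ i, rescale 2 (u i) * symbolSeries 0 1 a i l - u l

/-- Telescoping: u(ξ)â(ξ/2) agrees with u(ξ/2) to order M, and each further factor halves the
argument again. -/
theorem IsMatchingJet.iterateSeries {M : ℕ} {u : Fin r → ℂ⟦X⟧} (hu : IsMatchingJet a M u) (n : ℕ)
    (l : Fin r) :
    X ^ M ∣ ∑ i, u i * iterateSeries a 0 n i l - rescale ((2 : ℂ)⁻¹ ^ n) (u l) := by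
  induction n generalizing l with
  | zero => simp [iterateSeries_zero, Matrix.one_apply]
  | succ n ih =>
    have h1 : ∀ i l, symbolSeries 0 ((2 : ℝ)⁻¹ ^ (n + 1)) a i l =
        rescale ((2 : ℂ)⁻¹ ^ (n + 1)) (symbolSeries 0 1 a i l) := fun i l => by
      have := congrFun (congrFun (symbolSeries_map_rescale 0 1 ((2 : ℝ)⁻¹ ^ (n + 1)) a) i) l
      rw [mul_zero, mul_one, Matrix.map_apply] at this
      rw [← this]
      push_cast; rfl
    have h2 : ∑ i, u i * HermiteSubdivision.iterateSeries a 0 (n + 1) i l -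
        rescale ((2 : ℂ)⁻¹ ^ (n + 1)) (u l) =
        ∑ p, (∑ i, u i * HermiteSubdivision.iterateSeries a 0 n i p -
          rescale ((2 : ℂ)⁻¹ ^ n) (u p)) * symbolSeries 0 ((2 : ℝ)⁻¹ ^ (n + 1)) a p l +
        rescale ((2 : ℂ)⁻¹ ^ (n + 1)) (∑ i, rescale 2 (u i) * symbolSeries 0 1 a i l - u l) := by
      have h3 : ∀ p, rescale ((2 : ℂ)⁻¹ ^ (n + 1)) (rescale 2 (u p)) =
          rescale ((2 : ℂ)⁻¹ ^ n) (u p) := fun p => by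
        rw [rescale_rescale]
        congr 2
        rw [pow_succ]; ring
      simp only [iterateSeries_succ, Matrix.mul_apply, map_sub, map_sum, map_mul, h3, ← h1,
        sub_mul, Finset.sum_sub_distrib, Finset.sum_mul, Finset.mul_sum, mul_assoc]
      rw [Finset.sum_comm]
      ring
    rw [h2]
    exact dvd_add (Finset.dvd_sum fun p _ => (ih p).mul_right _) (X_pow_dvd_rescale (hu l) _)

namespace IsBasisVectorFunction

theorem exists_matchingJet (hφ : IsBasisVectorFunction a m φ) (hr : 0 < r) (hm : r - 1 ≤ m)
    (h0 : fourierTransform φ 0 ⟨0, hr⟩ = 1)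
    (hspan0 : Submodule.span ℂ
      (Set.range fun k : ℤ => fourierTransform φ (2 * Real.pi * k)) = ⊤) :
    ∃ υ : ℤ →₀ Matrix (Fin 1) (Fin r) ℂ,
      symbol υ 0 0 = Pi.single ⟨0, hr⟩ 1 ∧ IsMatchingJet a (m + 1) (symbolSeries 0 1 υ 0) := by
  have hconst : ∀ i l, coeff 0 (symbolSeries 0 1 a i l) = symbol a 0 i l := fun i l => by
    rw [coeff_zero_eq_constantCoeff_apply, constantCoeff_symbolSeries, mul_zero]
  obtain ⟨t, ht0, ht⟩ := exists_matching_jet (M := m) (symbolSeries 0 1 a)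
    (Pi.single ⟨0, hr⟩ 1) (fun l => by
      simp only [hconst, ← hφ.symbol_zero_row hr hm h0 l]
      simp [Pi.single_apply]) (fun j hj1 hjm b => by
      -- Singularity would make 2^{-j} an eigenvalue other than 1; the strict bound 2^{-m} excludes
      -- it up to and including j = m.
      have hunit : IsUnit (1 - (2 : ℂ) ^ j • symbol a 0) := by
        rw [Matrix.isUnit_iff_isUnit_det, isUnit_iff_ne_zero]
        intro hdet
        obtain ⟨y, hy0, hy⟩ := Matrix.exists_vecMul_eq_zero_iff.2 hdet
        have hy' : Matrix.vecMul y (symbol a 0) = ((2 : ℂ) ^ j)⁻¹ • y := by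
          rw [Matrix.vecMul_sub, Matrix.vecMul_one, Matrix.vecMul_smul, sub_eq_zero] at hy
          conv_rhs => rw [hy]
          rw [smul_smul, inv_mul_cancel₀ (pow_ne_zero _ two_ne_zero), one_smul]
        have hne : ((2 : ℂ) ^ j)⁻¹ ≠ 1 := by
          intro h
          have := congrArg norm h
          rw [norm_inv, norm_pow, Complex.norm_ofNat, norm_one, inv_eq_one] at this
          exact (one_lt_pow₀ (one_lt_two (α := ℝ)) (by omega)).ne' this
        have := hφ.norm_eigenvalue_lt hr hspan0 hne hy0 hy'
        rw [norm_inv, norm_pow, Complex.norm_ofNat] at this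
        have h3 : (2 : ℝ) ^ j ≤ 2 ^ m := pow_le_pow_right₀ one_le_two hjm
        exact absurd (inv_anti₀ (by positivity) h3) (not_le.2 this)
      obtain ⟨x, hx⟩ := Matrix.vecMul_surjective_iff_isUnit.2 hunit b
      refine ⟨x, fun l => ?_⟩
      have := congrFun hx l
      simp only at this
      rw [Matrix.vecMul_sub, Matrix.vecMul_one, Matrix.vecMul_smul] at this
      simpa [Matrix.vecMul, dotProduct, hconst] using this)
  obtain ⟨υ, hυ⟩ := exists_symbolSeries_jet (m + 1) fun j =>
    (Matrix.of fun (_ : Fin 1) l => t j l : Matrix (Fin 1) (Fin r) ℂ)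
  refine ⟨υ, ?_, fun l => X_pow_dvd_iff.2 fun j hj => ?_⟩
  · ext l
    have := hυ 0 (Nat.succ_pos m) 0 l
    rw [coeff_zero_eq_constantCoeff_apply, constantCoeff_symbolSeries, mul_zero] at this
    simpa [ht0] using this
  · rw [map_sub, hυ j hj, Matrix.of_apply, ← ht j (by omega) l, map_sum, sub_eq_zero]
    refine Finset.sum_congr rfl fun i _ => ?_
    rw [coeff_mul]
    refine Finset.sum_congr rfl fun p hp => ?_
    have := Finset.HasAntidiagonal.mem_antidiagonal.1 hp
    rw [coeff_rescale, hυ p.1 (by omega), Matrix.of_apply]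

/-- Here u is a jet at 0 and φ̂ is expanded at another point, so the pairing stands for u(ξ)φ̂(ξ +
2c); the refinement relation transfers it to base point c. -/
theorem rescale_pairing (hφ : IsBasisVectorFunction a m φ) (hr : 0 < r) (u : Fin r → ℂ⟦X⟧)
    (c : ℝ) :
    rescale 2 (∑ i, u i * momentSeries (2 * c) fun x => φ x i) =
      ∑ p, (∑ i, rescale 2 (u i) * symbolSeries c 1 a i p) * momentSeries c fun x => φ x p := by
  simp only [map_sum, map_mul, hφ.rescale_momentSeries hr, Finset.mul_sum, Finset.sum_mul]
  rw [Finset.sum_comm]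
  simp only [mul_assoc]

variable {u : Fin r → ℂ⟦X⟧}

/-- Self-similarity: periodicity replaces the expansion of â at 2πk by that at 0, where u absorbs it
up to order m. -/
theorem two_pow_mul_coeff_pairing (hφ : IsBasisVectorFunction a m φ) (hr : 0 < r)
    (hu : IsMatchingJet a (m + 1) u) (k : ℤ) {j : ℕ} (hj : j < m + 1) :
    2 ^ j * coeff j (∑ i, u i * momentSeries (2 * Real.pi * (2 * k : ℤ)) fun x => φ x i) =
      coeff j (∑ i, u i * momentSeries (2 * Real.pi * k) fun x => φ x i) := by
  rw [← coeff_rescale, show 2 * Real.pi * ((2 * k : ℤ) : ℝ) = 2 * (2 * Real.pi * k) by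
    push_cast; ring, hφ.rescale_pairing hr]
  refine coeff_eq_of_X_pow_dvd_sub ?_ hj
  rw [← Finset.sum_sub_distrib]
  refine Finset.dvd_sum fun p _ => ?_
  rw [← sub_mul]
  have h := symbolSeries_add_two_pi 0 k a
  rw [zero_add] at h
  rw [h]
  exact (hu p).mul_right _

/-- Iterated self-similarity equates the jth coefficient with 2^{jn} times the one at frequency 2ⁿk.
The latter is o(2^{-nm}) and j ≤ m, so a constant sequence tends to 0. -/
theorem X_pow_dvd_pairing (hφ : IsBasisVectorFunction a m φ) (hr : 0 < r)
    (hu : IsMatchingJet a (m + 1) u) {k : ℤ} (hk : k ≠ 0) :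
    X ^ (m + 1) ∣ ∑ i, u i * momentSeries (2 * Real.pi * k) fun x => φ x i := by
  rw [X_pow_dvd_iff]
  intro j hj
  have hiter : ∀ n : ℕ, (2 ^ j) ^ n *
      coeff j (∑ i, u i * momentSeries (2 * Real.pi * (2 ^ n * k : ℤ)) fun x => φ x i) =
      coeff j (∑ i, u i * momentSeries (2 * Real.pi * k) fun x => φ x i) := fun n => by
    induction n with
    | zero => simp
    | succ n ih =>
      rw [← ih, ← hφ.two_pow_mul_coeff_pairing hr hu (2 ^ n * k) hj, pow_succ ((2 : ℂ) ^ j),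
        mul_assoc, pow_succ' (2 : ℤ), mul_assoc (2 : ℤ)]
  have hlim : Tendsto (fun n : ℕ => ((2 : ℂ) ^ n) ^ m *
      coeff j (∑ i, u i * momentSeries (2 * Real.pi * (2 ^ n * k : ℤ)) fun x => φ x i))
      atTop (𝓝 0) := by
    have h := tendsto_finsetSum Finset.univ fun i _ =>
      tendsto_finsetSum (Finset.HasAntidiagonal.antidiagonal j) fun p _ =>
        (hφ.tendsto_two_pow_mul_coeff_momentSeries hk i p.2).const_mul (coeff p.1 (u i))
    simp only [mul_zero, Finset.sum_const_zero] at h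
    refine h.congr fun n => ?_
    simp only [map_sum, coeff_mul, Finset.mul_sum]
    exact Finset.sum_congr rfl fun i _ => Finset.sum_congr rfl fun p _ => by ring
  have hbound : Tendsto (fun n : ℕ => ((2 : ℂ) ^ j) ^ n *
      coeff j (∑ i, u i * momentSeries (2 * Real.pi * (2 ^ n * k : ℤ)) fun x => φ x i))
      atTop (𝓝 0) := by
    refine squeeze_zero_norm (fun n => ?_) (tendsto_zero_iff_norm_tendsto_zero.1 hlim)
    rw [norm_mul, norm_mul]
    refine mul_le_mul_of_nonneg_right ?_ (norm_nonneg _)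
    rw [← pow_mul, ← pow_mul, norm_pow, norm_pow, Complex.norm_ofNat, mul_comm j]
    exact pow_le_pow_right₀ one_le_two (Nat.mul_le_mul_left n (by omega))
  simp only [hiter] at hbound
  exact tendsto_nhds_unique tendsto_const_nhds hbound

/-- Frequency 0 is fixed by doubling, so (2^j - 1) annihilates the jth coefficient for 1 ≤ j ≤ m. -/
theorem X_pow_dvd_pairing_zero_sub_one (hφ : IsBasisVectorFunction a m φ) (hr : 0 < r)
    (hu : IsMatchingJet a (m + 1) u)
    (hu0 : ∑ i, constantCoeff (u i) * fourierTransform φ 0 i = 1) :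
    X ^ (m + 1) ∣ ∑ i, u i * momentSeries 0 (fun x => φ x i) - 1 := by
  rw [X_pow_dvd_iff]
  intro j hj
  rcases Nat.eq_zero_or_pos j with rfl | hj0
  · simpa [hφ.fourierTransform_apply, sub_eq_zero] using hu0
  · have h := hφ.two_pow_mul_coeff_pairing hr hu 0 hj
    simp only [mul_zero, Int.cast_zero] at h
    rw [map_sub, coeff_one, if_neg hj0.ne', sub_zero]
    have h2 : (2 : ℂ) ^ j - 1 ≠ 0 := by
      rw [sub_ne_zero]
      exact_mod_cast (Nat.one_lt_two_pow hj0.ne').ne'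
    refine (mul_eq_zero.1 ?_).resolve_left h2
    rw [sub_mul, h, one_mul, sub_self]

/-- The second sum rule, at `ξ = π`. -/
theorem X_pow_dvd_symbolSeries_pi (hφ : IsBasisVectorFunction a m φ) (hr : 0 < r)
    (hu : IsMatchingJet a (m + 1) u)
    (hspanpi : Submodule.span ℂ
      (Set.range fun k : ℤ => fourierTransform φ (Real.pi + 2 * Real.pi * k)) = ⊤) (l : Fin r) :
    X ^ (m + 1) ∣ ∑ i, rescale 2 (u i) * symbolSeries Real.pi 1 a i l := by
  set B : Fin r → ℂ⟦X⟧ := fun l => ∑ i, rescale 2 (u i) * symbolSeries Real.pi 1 a i l with hB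
  -- This pairing is the dilate of the one at frequency 2k + 1, which is never 0.
  have hpair : ∀ k : ℤ, X ^ (m + 1) ∣
      ∑ p, B p * momentSeries (Real.pi + 2 * Real.pi * k) fun x => φ x p := fun k => by
    have h := hφ.rescale_pairing hr u (Real.pi + 2 * Real.pi * k)
    rw [symbolSeries_add_two_pi] at h
    rw [hB, ← h, show 2 * (Real.pi + 2 * Real.pi * k) = 2 * Real.pi * ((2 * k + 1 : ℤ) : ℝ) by
      push_cast; ring]
    exact X_pow_dvd_rescale (hφ.X_pow_dvd_pairing hr hu (by omega)) _
  suffices H : ∀ j < m + 1, ∀ l, coeff j (B l) = 0 from X_pow_dvd_iff.2 fun j hj => H j hj l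
  intro j
  induction j using Nat.strong_induction_on with
  | _ j ih =>
    intro hj
    by_contra! hne
    have hy : (fun l => coeff j (B l)) ≠ 0 := Function.ne_iff.2 hne
    -- With all lower coefficients of B zero, the jth coefficient of the pairing is that of B
    -- against the constant term φ̂(π + 2πk), and these vectors span.
    obtain ⟨k, hk⟩ := exists_dotProduct_ne_zero hspanpi hy
    refine hk ?_
    have h := X_pow_dvd_iff.1 (hpair k) j hj
    rw [map_sum] at h
    rw [← h, dotProduct]
    refine Finset.sum_congr rfl fun p _ => ?_
    rw [coeff_mul, Finset.sum_eq_single (j, 0)]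
    · simp [hφ.fourierTransform_apply]
    · intro q hq hq'
      have hqj := Finset.HasAntidiagonal.mem_antidiagonal.1 hq
      have : q.1 < j := by
        refine lt_of_le_of_ne (by omega) fun h => hq' (Prod.ext h ?_)
        simp only; omega
      rw [ih q.1 this (this.trans hj), zero_mul]
    · intro h
      exact absurd (Finset.HasAntidiagonal.mem_antidiagonal.2 (by simp)) h

/-- The Hermite structure of the matching filter. -/
theorem coeff_matchingJet (hφ : IsBasisVectorFunction a m φ) (hr : 0 < r) (hm : r - 1 ≤ m)
    (hu : IsMatchingJet a (m + 1) u)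
    (hu0 : ∑ i, constantCoeff (u i) * fourierTransform φ 0 i = 1) (l : Fin r) {j : ℕ}
    (hj : j ≤ l) : coeff j (u l) = if j = l then Complex.I ^ (l : ℕ) else 0 := by
  have hjm : j < m + 1 := by have := l.2; omega
  -- The Riemann-sum limit is (iX)^l times the pairing at 0, which is 1 through order m.
  have hlim : Tendsto (fun n : ℕ => coeff j (∑ i, u i * iterateSeries a 0 n i l) *
      2 ^ (n * (l : ℕ))) atTop (𝓝 (if j = l then Complex.I ^ (l : ℕ) else 0)) := by
    have h := tendsto_finsetSum Finset.univ fun i _ =>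
      tendsto_finsetSum (Finset.HasAntidiagonal.antidiagonal j) fun p _ =>
        (hφ.tendsto_coeff_iterateSeries hm 0 i l p.2).const_mul (coeff p.1 (u i))
    have hval : ∑ i, ∑ p ∈ Finset.HasAntidiagonal.antidiagonal j, coeff p.1 (u i) *
        coeff p.2 ((C (Complex.I * (0 : ℝ)) + C Complex.I * X) ^ (l : ℕ) *
          momentSeries 0 fun x => φ x i) = if j = l then Complex.I ^ (l : ℕ) else 0 := by
      simp only [← coeff_mul, ← map_sum]
      simp only [Complex.ofReal_zero, mul_zero, map_zero, zero_add, mul_left_comm (u _),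
        ← Finset.mul_sum]
      have h1 := (hφ.X_pow_dvd_pairing_zero_sub_one hr hu hu0).mul_left ((C Complex.I * X) ^ (l : ℕ))
      rw [mul_sub, mul_one] at h1
      rw [coeff_eq_of_X_pow_dvd_sub h1 hjm, mul_pow, ← map_pow, coeff_C_mul, coeff_X_pow]
      split_ifs <;> simp
    rw [hval] at h
    refine h.congr fun n => ?_
    simp only [map_sum, coeff_mul, Finset.sum_mul, mul_assoc]
  -- Telescoping evaluates the same sequence as 2^{n(l-j)} times the jth coefficient of u_l:
  -- convergence forces 0 for j < l and identifies the value for j = l.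
  have hcoeff : ∀ n : ℕ, coeff j (∑ i, u i * iterateSeries a 0 n i l) * 2 ^ (n * (l : ℕ)) =
      ((2 : ℂ) ^ ((l : ℕ) - j)) ^ n * coeff j (u l) := fun n => by
    rw [coeff_eq_of_X_pow_dvd_sub (hu.iterateSeries n l) hjm, coeff_rescale]
    have h1 : (2 : ℂ) ^ (n * (l : ℕ)) = (2 ^ ((l : ℕ) - j)) ^ n * (2 ^ n) ^ j := by
      rw [← pow_mul, ← pow_mul, ← pow_add, mul_comm _ n, ← mul_add, Nat.sub_add_cancel hj]
    rw [h1, inv_pow, inv_pow]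
    field_simp
  simp only [hcoeff] at hlim
  rcases hj.eq_or_lt with rfl | hlt
  · simp only [Nat.sub_self, pow_zero, one_pow, one_mul, if_true] at hlim
    rw [if_pos rfl]
    exact tendsto_nhds_unique tendsto_const_nhds hlim
  · rw [if_neg hlt.ne] at hlim ⊢
    have h0 : Tendsto (fun n : ℕ => ((2 : ℂ)⁻¹ ^ ((l : ℕ) - j)) ^ n) atTop (𝓝 0) :=
      tendsto_pow_atTop_nhds_zero_of_norm_lt_one (by
        rw [norm_pow]
        exact pow_lt_one₀ (norm_nonneg _) (by norm_num) (by omega))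
    have := h0.mul hlim
    rw [mul_zero] at this
    refine tendsto_nhds_unique tendsto_const_nhds (this.congr fun n => ?_)
    rw [← mul_assoc, ← mul_pow, ← mul_pow, inv_mul_cancel₀ two_ne_zero, one_pow, one_pow, one_mul]

end IsBasisVectorFunction

/-! ### Translating jets into the asymptotic statements. -/

theorem hasSumRules_of_isMatchingJet {M : ℕ} {υ : ℤ →₀ Matrix (Fin 1) (Fin r) ℂ}
    (h0 : symbol υ 0 ≠ 0) (hυ : IsMatchingJet a M (symbolSeries 0 1 υ 0))
    (hpi : ∀ l, X ^ M ∣ ∑ i, rescale 2 (symbolSeries 0 1 υ 0 i) * symbolSeries Real.pi 1 a i l) :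
    HasSumRules a M υ := by
  have hυe : ∀ l, HasExpansion (fun ξ => symbol υ ξ 0 l) (symbolSeries 0 1 υ 0 l) := fun l => by
    simpa using hasExpansion_symbol 0 υ 0 l
  have hυe2 : ∀ l, HasExpansion (fun ξ => symbol υ (2 * ξ) 0 l)
      (rescale 2 (symbolSeries 0 1 υ 0 l)) := fun l => by
    simpa using (hυe l).comp_mul 2
  refine ⟨h0, fun l => ?_, fun l => ?_⟩
  · refine HasExpansion.isBigO (p := _) ?_ (hυ l)
    simp only [Matrix.mul_apply]
    refine (HasExpansion.sum _ fun i _ => (hυe2 i).mul ?_).sub (hυe l)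
    simpa using hasExpansion_symbol 0 a i l
  · refine HasExpansion.isBigO (p := _) ?_ (hpi l)
    simp only [Matrix.mul_apply]
    exact HasExpansion.sum _ fun i _ => (hυe2 i).mul (hasExpansion_symbol _ a i l)

theorem hasHermiteLeadingTerms_of_coeff {υ : ℤ →₀ Matrix (Fin 1) (Fin r) ℂ}
    (h : ∀ l : Fin r, ∀ j ≤ (l : ℕ),
      coeff j (symbolSeries 0 1 υ 0 l) = if j = l then Complex.I ^ (l : ℕ) else 0) :
    HasHermiteLeadingTerms υ := fun l => by
  refine HasExpansion.isBigO (p := symbolSeries 0 1 υ 0 l - (C Complex.I * X) ^ (l : ℕ)) ?_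
    (X_pow_dvd_iff.2 fun j hj => ?_)
  · refine HasExpansion.sub (by simpa using hasExpansion_symbol 0 υ 0 l) ?_
    exact ((HasExpansion.const _).mul HasExpansion.id).pow _
  · rw [map_sub, h l j (by omega), mul_pow, ← map_pow, coeff_C_mul, coeff_X_pow]
    split_ifs <;> simp

theorem hasHermiteForm_of_coeff {M : ℕ} (hM : 0 < M) {υ : ℤ →₀ Matrix (Fin 1) (Fin r) ℂ}
    (h : ∀ l : Fin r, ∀ j ≤ (l : ℕ),
      coeff j (symbolSeries 0 1 υ 0 l) = if j = l then Complex.I ^ (l : ℕ) else 0) :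
    HasHermiteForm υ M := by
  -- The lth jet is that of υ̂_l divided by (iX)^l, legitimate because lower coefficients vanish; it
  -- is realized by a 1 × 1 matrix sequence, whose trace gives the scalar one.
  choose c hc using fun l : Fin r => exists_symbolSeries_jet M fun j =>
    (Matrix.of fun (_ _ : Fin 1) =>
      (Complex.I ^ (l : ℕ))⁻¹ * coeff (j + l) (symbolSeries 0 1 υ 0 l))
  have hIl : ∀ l : Fin r, Complex.I ^ (l : ℕ) ≠ 0 := fun l => pow_ne_zero _ Complex.I_ne_zero
  have hsym : ∀ l ξ, symbol ((c l).mapRange Matrix.trace (Matrix.trace_zero _ _)) ξ = symbol (c l) ξ 0 0 :=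
    fun l ξ => by
      rw [symbol_apply, symbol, Finsupp.sum_mapRange_index (by simp)]
      simp [Matrix.trace_fin_one]
  refine ⟨fun l => (c l).mapRange Matrix.trace (Matrix.trace_zero _ _), fun l => ?_, fun l => ?_⟩
  · have := hc l 0 hM 0 0
    rw [coeff_zero_eq_constantCoeff_apply, constantCoeff_symbolSeries, mul_zero] at this
    rw [hsym, this, Matrix.of_apply, zero_add, h l l le_rfl, if_pos rfl, inv_mul_cancel₀ (hIl l)]
  · simp only [hsym]
    refine HasExpansion.isBigO (p := symbolSeries 0 1 υ 0 l -
      (C Complex.I * X) ^ (l : ℕ) * symbolSeries 0 1 (c l) 0 0) ?_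
      (X_pow_dvd_iff.2 fun j hj => ?_)
    · refine HasExpansion.sub (by simpa using hasExpansion_symbol 0 υ 0 l) (.mul ?_ ?_)
      · exact ((HasExpansion.const _).mul HasExpansion.id).pow _
      · simpa using hasExpansion_symbol 0 (c l) 0 0
    · rw [map_sub, mul_pow, ← map_pow, mul_assoc, coeff_C_mul, coeff_X_pow_mul', sub_eq_zero]
      split_ifs with hlj
      · rw [hc l _ (by omega), Matrix.of_apply, mul_inv_cancel_left₀ (hIl l),
          Nat.sub_add_cancel hlj]
      · rw [h l j (by omega), if_neg (by omega), mul_zero]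

end Main

end

end HermiteSubdivision

/-! ### The theorem. -/

open HermiteSubdivision in
theorem theorem1p2 (r m : ℕ) (hr : 0 < r) (hm : r - 1 ≤ m)
    (a : ℤ →₀ Matrix (Fin r) (Fin r) ℂ) (hconv : IsConvergent a m)
    (φ : ℝ → Fin r → ℂ) (hφ : IsBasisVectorFunction a m φ)
    (hspan0 : Submodule.span ℂ
      (Set.range fun k : ℤ => fourierTransform φ (2 * Real.pi * k)) = ⊤)
    (hspanpi : Submodule.span ℂ
      (Set.range fun k : ℤ => fourierTransform φ (Real.pi + 2 * Real.pi * k)) = ⊤) :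
    -- (1) `1` is an algebraically simple eigenvalue of `â(0)`, the others are below `2^{-m}`
    ((symbol a 0).charpoly.rootMultiplicity 1 = 1 ∧
      ∀ μ : ℂ, Module.End.HasEigenvalue (Matrix.toLin' (symbol a 0)) μ → μ ≠ 1 →
        ‖μ‖ < ((2 : ℝ) ^ m)⁻¹) ∧
    -- (2) `a` is a Hermite mask of accuracy order `m + 1`
    (∃ υ : ℤ →₀ Matrix (Fin 1) (Fin r) ℂ,
      HasSumRules a (m + 1) υ ∧ HasHermiteLeadingTerms υ ∧ HasHermiteForm υ (m + 1)) ∧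
    -- (3) `φ` is refinable and normalized, and its Fourier transform is the infinite product
    ((∀ x : ℝ, φ x = (2 : ℂ) • a.sum fun k A => Matrix.mulVec A (φ (2 * x - k))) ∧
      fourierTransform φ 0 ⟨0, hr⟩ = 1 ∧
      ∀ ξ : ℝ, Tendsto
        (fun n : ℕ => Matrix.mulVec (symbolProduct a ξ n) (Pi.single ⟨0, hr⟩ 1))
        atTop (𝓝 (fourierTransform φ ξ))) := by
  -- Spanning applied to e₁ supplies a frequency where φ̂ does not vanish, as the normalization
  -- needs.
  obtain ⟨k, hk⟩ := exists_dotProduct_ne_zero hspan0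
    (y := Pi.single ⟨0, hr⟩ 1) (by simp [Pi.single_eq_zero_iff])
  have h0 : fourierTransform φ 0 ⟨0, hr⟩ = 1 :=
    hφ.fourierTransform_zero_apply hr hm (ξ := 2 * Real.pi * k) fun h => hk (by simp [h])
  refine ⟨⟨rootMultiplicity_charpoly_one_of_tendsto_pow h0 (hφ.tendsto_symbol_zero_pow hr hm),
    fun μ hμ hμ1 => ?_⟩, ?_, hφ.refinable hr, h0, hφ.tendsto_symbolProduct_mulVec hr hm⟩
  · obtain ⟨v, hv⟩ := hμ.exists_hasEigenvector
    have hdet : (symbol a 0 - μ • 1).det = 0 :=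
      Matrix.exists_mulVec_eq_zero_iff.1 ⟨v, hv.2, by
        have := hv.apply_eq_smul
        rw [Matrix.toLin'_apply] at this
        rw [Matrix.sub_mulVec, this, Matrix.smul_mulVec, Matrix.one_mulVec, sub_self]⟩
    -- The spectral bound pairs left eigenvectors with φ̂, so the right eigenvector is exchanged for
    -- a left one through the determinant.
    obtain ⟨y, hy0, hy⟩ := Matrix.exists_vecMul_eq_zero_iff.2 hdet
    refine hφ.norm_eigenvalue_lt hr hspan0 hμ1 hy0 ?_
    rwa [Matrix.vecMul_sub, Matrix.vecMul_smul, Matrix.vecMul_one, sub_eq_zero] at hy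
  · obtain ⟨υ, hυ0, hυ⟩ := hφ.exists_matchingJet hr hm h0 hspan0
    have hpair : ∑ i, PowerSeries.constantCoeff (symbolSeries 0 1 υ 0 i) * fourierTransform φ 0 i = 1 := by
      simp only [constantCoeff_symbolSeries, mul_zero, hυ0]
      simp [Pi.single_apply, h0]
    have hcoeff := fun (l : Fin r) (j : ℕ) (hj : j ≤ l) =>
      hφ.coeff_matchingJet hr hm hυ hpair l hj
    refine ⟨υ, hasSumRules_of_isMatchingJet (fun h => ?_) hυ
      (hφ.X_pow_dvd_symbolSeries_pi hr hυ hspanpi), hasHermiteLeadingTerms_of_coeff hcoeff,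
      hasHermiteForm_of_coeff m.succ_pos hcoeff⟩
    have := congrFun (congrFun h 0) ⟨0, hr⟩
    rw [hυ0] at this
    simp at this
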